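/- **Martingale Fishmonger has limiting MVP $H_0/2$.** *The sketch.* Fix $m\ge 1$. The unit square is divided into $m$ columns of width $1/m$, indexed $i=0,\dots,m-1$, with offsets $r_i=i/m$. In column $i$ there is, for every integer $j\ge 0$, a cell occupying the heights $[e^{-(r_i+j+1)},e^{-(r_i+j)})$; the rest of the column, $[e^{-r_i},1)$, is a dummy cell that is always occupied. Each new distinct element throws an independent uniformly random dart at the square (duplicates have no effect). The state $S_{m,k}$ of smoothed base-$e$ PCSA after $k$ distinct elements is the set of non-dummy cells that contain at least one of the first $k$ darts. Let $P_{m,k}=\Pr(S_{m,k}\ne S_{m,k-1}\mid S_{m,k-1})$ be the state changing probability, and let $$E_{m,n}=\sum_{k=1}^{n}\frac{\mathbf 1[S_{m,k}\neq S_{m,k-1}]}{P_{m,k}}$$ be the martingale estimator. The memory of Martingale Fishmonger is that of the entropy-compressed state: the Shannon entropy $H(S_{m,n})$ in bits. The darts used for different values of $m$ may be coupled arbitrarily. Let $$H_0=\frac1{\ln 2}+\sum_{k=1}^\infty \frac{\log_2(1+1/k)}{k}.$$ *The claim.* All $E_{m,n}$ have finite variance and all $S_{m,n}$ have finite entropy.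 In the limits below, $m$ and $\lambda$ range over the positive integers and, for each fixed $\lambda$, the inner limit $m\to\infty$ exists. 1. The sketch is scale-invariant with $\kappa=1$: for every $\lambda$ there is a constant $\kappa_\lambda$ with $\lambda P_{m,\lambda m}\to\kappa_\lambda$ almost surely as $m\to\infty$, and $\kappa_\lambda\to 1$ as $\lambda\to\infty$. 2. The asymptotic relative variance factor is $\displaystyle\lim_{\lambda\to\infty}\lim_{m\to\infty} m\,\frac{\operatorname{Var}(E_{m,\lambda m})}{(\lambda m)^2}=\frac12$, and $\displaystyle\lim_{\lambda\to\infty}\lim_{m\to\infty}\frac{H(S_{m,\lambda m})}{m}=H_0$. 3. The limiting memory-variance product is $$\lim_{\lambda\to\infty}\lim_{m\to\infty} H(S_{m,\lambda m})\cdot\frac{\operatorname{Var}(E_{m,\lambda m})}{(\lambda m)^2}=\frac{H_0}{2}.$$ The same holds if $H(S_{m,\lambda m})$ is replaced by $H(S_{m,\lambda m})+b_{m,\lambda m}$, for any real numbers $b_{m,n}$ with $b_{m,\lambda m}=o(m)$ as $m\to\infty$ for every fixed $\lambda$ (for instance, the word that stores the estimate). 4. $H_0/2\approx 1.63$, that is,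 $|H_0/2-1.63|<0.005$. -/

import Mathlib

open MeasureTheory ProbabilityTheory Filter Topology

namespace Dartboard

/-- A dart is a uniformly random point of the unit square (column coordinate, height coordinate). -/
noncomputable def dartLaw : Measure (ℝ × ℝ) :=
  volume.restrict (Set.Icc (0 : ℝ) 1 ×ˢ Set.Icc (0 : ℝ) 1)

/-- The uniform offset vector `(0, 1/m, 2/m, …, (m-1)/m)`. -/
noncomputable def offset {m : ℕ} (i : Fin m) : ℝ := (i : ℝ) / m

/-- The cells of the smoothed base-`q` partition with `m` columns. In column `i`, the cell
`[q^{-(j+1)}, q^{-j})` is scaled down by the factor `q^{-r_i}`, where `r_i` is the offset. What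
remains of the column, `[q^{-r_i}, 1)`, is the dummy cell, which is always occupied; it is not
recorded in the state. -/
noncomputable def cellRegion (q : ℝ) {m : ℕ} (c : Fin m × ℕ) : Set (ℝ × ℝ) :=
  Set.Ico ((c.1 : ℝ) / m) (((c.1 : ℝ) + 1) / m) ×ˢ
    Set.Ico (q ^ (-(offset c.1 + (c.2 + 1 : ℝ)))) (q ^ (-(offset c.1 + (c.2 : ℝ))))

open Classical in
/-- The cell hit by a dart, and `none` if the dart hits a dummy cell (or one of the boundary
lines of the square that belong to no cell). For `1 < q` the cells are pairwise disjoint, so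
that the choice is unique. -/
noncomputable def cellOf (q : ℝ) (m : ℕ) (y : ℝ × ℝ) : Option (Fin m × ℕ) :=
  if h : ∃ c : Fin m × ℕ, y ∈ cellRegion q c then some h.choose else none

/-- The transition of smoothed `q`-PCSA: the state is the set of (non-dummy) cells that contain
a dart. -/
noncomputable def update (q : ℝ) (m : ℕ) (s : Finset (Fin m × ℕ)) (y : ℝ × ℝ) :
    Finset (Fin m × ℕ) :=
  s ∪ (cellOf q m y).toFinset

/-- The state `S_k` of smoothed `q`-PCSA with `m` columns after `k` distinct elements, whose
darts are `x 0, …, x (k-1)`. -/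
noncomputable def sketch (q : ℝ) (m : ℕ) (x : ℕ → ℝ × ℝ) : ℕ → Finset (Fin m × ℕ)
  | 0 => ∅
  | k + 1 => update q m (sketch q m x k) (x k)

/-- The state changing probability `P_k` (for `k ≥ 1`): the probability that a fresh dart changes
the state `S_{k-1}`. -/
noncomputable def changeProb (q : ℝ) (m : ℕ) (x : ℕ → ℝ × ℝ) (k : ℕ) : ℝ :=
  dartLaw.real {y | update q m (sketch q m x (k - 1)) y ≠ sketch q m x (k - 1)}

/-- The martingale estimator `E_n = ∑_{k=1}^n 1[S_k ≠ S_{k-1}] / P_k`. -/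
noncomputable def martingaleEstimator (q : ℝ) (m : ℕ) (x : ℕ → ℝ × ℝ) (n : ℕ) : ℝ :=
  ∑ k ∈ Finset.Icc 1 n,
    if sketch q m x k ≠ sketch q m x (k - 1) then 1 / changeProb q m x k else 0

/-- The summands of the Shannon entropy, in bits, of a random variable `X` with values in a
countable type. -/
noncomputable def entropyTerm {Ω S : Type*} [MeasurableSpace Ω] (μ : Measure Ω) (X : Ω → S)
    (s : S) : ℝ :=
  -(μ.real (X ⁻¹' {s}) * Real.logb 2 (μ.real (X ⁻¹' {s})))

/-- Shannon entropy in bits. -/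
noncomputable def entropyBits {Ω S : Type*} [MeasurableSpace Ω] (μ : Measure Ω) (X : Ω → S) : ℝ :=
  ∑' s, entropyTerm μ X s

/-- `H₀ = (ln 2)⁻¹ + ∑_{k ≥ 1} k⁻¹ log₂ (1 + 1/k)`. -/
noncomputable def H0 : ℝ :=
  (Real.log 2)⁻¹ + ∑' k : ℕ, ((k : ℝ) + 1)⁻¹ * Real.logb 2 (1 + 1 / ((k : ℝ) + 1))

/-- `lim_{l → ∞} lim_{m → ∞} f l m = a`, where the inner limit exists for every `l ≥ 1`. -/
def HasIteratedLimit (f : ℕ → ℕ → ℝ) (a : ℝ) : Prop :=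
  ∃ L : ℕ → ℝ, (∀ l, 1 ≤ l → Tendsto (fun m => f l m) atTop (𝓝 (L l))) ∧ Tendsto L atTop (𝓝 a)

/-- Scale-invariance with constant `κ` of a family of sketches with `m` subsketches and state
changing probabilities `P m k`: for every `l ≥ 1`, `l * P m (l * m)` converges almost surely to
a constant `κ_l` as `m → ∞`, and `κ_l → κ` as `l → ∞`. -/
def IsScaleInvariant {Ω : Type*} [MeasurableSpace Ω] (μ : Measure Ω) (P : ℕ → ℕ → Ω → ℝ)
    (κ : ℝ) : Prop :=
  ∃ κl : ℕ → ℝ,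
    (∀ l : ℕ, 1 ≤ l → ∀ᵐ ω ∂μ, Tendsto (fun m : ℕ => (l : ℝ) * P m (l * m) ω) atTop (𝓝 (κl l))) ∧
    Tendsto κl atTop (𝓝 κ)

/-- The relative variance `Var(E_{m,n}) / n²` of the martingale estimator of base-`e` smoothed
PCSA with `m` columns after `n` distinct elements; `dart m k` is the dart of the element number
`k + 1` in the sketch with `m` columns. -/
noncomputable def fishmongerRelVar {Ω : Type*} [MeasurableSpace Ω] (μ : Measure Ω)
    (dart : ℕ → ℕ → Ω → ℝ × ℝ) (m n : ℕ) : ℝ :=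
  Var[fun ω => martingaleEstimator (Real.exp 1) m (fun k => dart m k ω) n; μ] / (n : ℝ) ^ 2

/-- The memory, in bits, of the entropy-compressed base-`e` smoothed PCSA sketch with `m` columns
after `n` distinct elements: the Shannon entropy of its state. -/
noncomputable def fishmongerEntropy {Ω : Type*} [MeasurableSpace Ω] (μ : Measure Ω)
    (dart : ℕ → ℕ → Ω → ℝ × ℝ) (m n : ℕ) : ℝ :=
  entropyBits μ (fun ω => sketch (Real.exp 1) m (fun k => dart m k ω) n)

end Dartboard

open Dartboard

/-!
Only the cell hit by a dart matters, so the sketch is the set of values taken by the first `n` terms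
of an i.i.d. sequence of cells. In base `q`, listing the cells by decreasing area, the `k`-th one
has area `ρ (k / m) / m` with `ρ u = q ^ (-u) * (1 - q⁻¹)`, and every quantity of interest is
asymptotically a Riemann sum over `u = k / m` with `n = l * m` darts.

* Variance. The estimator minus `n` is a martingale, and orthogonality of its increments gives
  `Var E_n = ∑ k ≤ n, (E[1 / P_k] - 1)`. The free area `P_k` moves by at most `1 / m` when one dart
  moves, so it concentrates around its mean, a Riemann sum of `P t = ∫ ρ * exp (-t * ρ)`
  for `k = t * m`. As `P t ~ 1 / (t * log q)`, the limit of `m * Var E_n / n ^ 2`, which is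
  `l⁻² * ∫ t in 0..l, (1 / P t - 1)`, tends to `log q / 2`.
* Entropy. By subadditivity the entropy of the state is at most the sum of the entropies of the
  individual cells. Conversely, the `J * m` largest cells are so nearly independent that their joint
  entropy loses only a term bounded in `m`. Both bounds give `∫ h (exp (-l * ρ))`, with `h` the
  binary entropy, and this integral tends to `H0 / log q` bits.

The base cancels in the product.
-/

namespace Dartboard

section IID

/-- The random variables `Y 0, Y 1, …` are independent and have the common law `ν`. -/
structure IsIIDSequence {Ω E : Type*} [MeasurableSpace Ω] [MeasurableSpace E] (μ : Measure Ω)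
    (ν : Measure E) (Y : ℕ → Ω → E) : Prop where
  measurable : ∀ k, Measurable (Y k)
  map_eq : ∀ k, μ.map (Y k) = ν
  iIndepFun : iIndepFun Y μ

namespace IsIIDSequence

variable {Ω E F : Type*} [MeasurableSpace Ω] [MeasurableSpace E] [MeasurableSpace F]
  {μ : Measure Ω} {ν : Measure E} {Y : ℕ → Ω → E}

theorem comp (h : IsIIDSequence μ ν Y) {g : E → F} (hg : Measurable g) :
    IsIIDSequence μ (ν.map g) (fun k => g ∘ Y k) where
  measurable k := hg.comp (h.measurable k)
  map_eq k := by rw [← h.map_eq k, Measure.map_map hg (h.measurable k)]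
  iIndepFun := h.iIndepFun.comp _ fun _ => hg

theorem isProbabilityMeasure [IsProbabilityMeasure μ] (h : IsIIDSequence μ ν Y) :
    IsProbabilityMeasure ν := by
  rw [← h.map_eq 0]
  exact Measure.isProbabilityMeasure_map (h.measurable 0).aemeasurable

theorem measureReal_preimage (h : IsIIDSequence μ ν Y) (k : ℕ) {s : Set E}
    (hs : MeasurableSet s) : μ.real (Y k ⁻¹' s) = ν.real s := by
  rw [← h.map_eq k, map_measureReal_apply (h.measurable k) hs]

theorem measureReal_forall_mem (h : IsIIDSequence μ ν Y) {n : ℕ} {B : Fin n → Set E}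
    (hB : ∀ i, MeasurableSet (B i)) :
    μ.real {ω | ∀ i : Fin n, Y i ω ∈ B i} = ∏ i, ν.real (B i) := by
  have hset : {ω | ∀ i : Fin n, Y i ω ∈ B i} = ⋂ i ∈ Finset.univ, Y (i : Fin n) ⁻¹' B i := by
    ext ω
    simp
  rw [hset, measureReal_def, (h.iIndepFun.precomp Fin.val_injective).measure_inter_preimage_eq_mul
    Finset.univ fun i _ => hB i, ENNReal.toReal_prod]
  exact Finset.prod_congr rfl fun i _ => h.measureReal_preimage i (hB i)

theorem indepFun_restrict (h : IsIIDSequence μ ν Y) (n : ℕ) :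
    IndepFun (fun ω (i : Set.Iio n) => Y i ω) (Y n) μ := by
  have hfin := h.iIndepFun.indepFun_finset (Finset.Iio n) {n} (by simp) h.measurable
  have hlast : Measurable fun z : (({n} : Finset ℕ) → E) => z ⟨n, Finset.mem_singleton_self n⟩ :=
    measurable_pi_apply _
  exact hfin.comp (φ := fun z (i : Set.Iio n) => z ⟨i, Finset.mem_Iio.2 i.2⟩)
    (by fun_prop) hlast

variable [Countable E] [DiscreteMeasurableSpace E]

theorem measurable_of_dependsOn {β : Type*} [Nonempty β] [MeasurableSpace β]
    (h : IsIIDSequence μ ν Y) {n : ℕ} {f : (ℕ → E) → β} (hf : DependsOn f (Set.Iio n)) :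
    Measurable fun ω => f (Y · ω) := by
  obtain ⟨g, rfl⟩ := dependsOn_iff_exists_comp.1 hf
  exact (measurable_of_countable g).comp (measurable_pi_lambda _ fun i => h.measurable i)

theorem integrable_of_dependsOn [IsFiniteMeasure μ] (h : IsIIDSequence μ ν Y) {n : ℕ}
    {f : (ℕ → E) → ℝ} (hf : DependsOn f (Set.Iio n)) {B : ℝ} (hB : ∀ y, |f y| ≤ B) :
    Integrable (fun ω => f (Y · ω)) μ :=
  .of_bound (h.measurable_of_dependsOn hf).aestronglyMeasurable B (ae_of_all _ fun _ => hB _)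

theorem integral_dependsOn_apply [IsProbabilityMeasure μ] (h : IsIIDSequence μ ν Y) {n : ℕ}
    {G : (ℕ → E) → E → ℝ} (hG : DependsOn G (Set.Iio n)) {B : ℝ} (hB : ∀ y e, |G y e| ≤ B) :
    ∫ ω, G (Y · ω) (Y n ω) ∂μ = ∫ ω, ∫ e, G (Y · ω) e ∂ν ∂μ := by
  obtain ⟨g, rfl⟩ := dependsOn_iff_exists_comp.1 hG
  have := h.isProbabilityMeasure
  set Z : Ω → (Set.Iio n → E) := fun ω i => Y i ω
  have hZ : Measurable Z := measurable_pi_lambda _ fun i => h.measurable i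
  have := Measure.isProbabilityMeasure_map (μ := μ) hZ.aemeasurable
  have hmap : μ.map (fun ω => (Z ω, Y n ω)) = (μ.map Z).prod ν := by
    rw [(indepFun_iff_map_prod_eq_prod_map_map hZ.aemeasurable
      (h.measurable n).aemeasurable).1 (h.indepFun_restrict n), h.map_eq n]
  have hg : Measurable (Function.uncurry g) := measurable_of_countable _
  have hint : Integrable (Function.uncurry g) (μ.map fun ω => (Z ω, Y n ω)) := by
    rw [integrable_map_measure hg.aestronglyMeasurable (hZ.prodMk (h.measurable n)).aemeasurable]
    exact .of_bound (hg.comp (hZ.prodMk (h.measurable n))).aestronglyMeasurable B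
      (ae_of_all _ fun ω => hB (Y · ω) (Y n ω))
  calc ∫ ω, g (Z ω) (Y n ω) ∂μ
      = ∫ p, Function.uncurry g p ∂(μ.map fun ω => (Z ω, Y n ω)) :=
        (integral_map (hZ.prodMk (h.measurable n)).aemeasurable hg.aestronglyMeasurable).symm
    _ = ∫ z, ∫ e, g z e ∂ν ∂(μ.map Z) := by
        rw [hmap] at hint ⊢
        exact integral_prod _ hint
    _ = ∫ ω, ∫ e, g (Z ω) e ∂ν ∂μ :=
        integral_map hZ.aemeasurable (measurable_of_countable _).aestronglyMeasurable

end IsIIDSequence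

end IID

section Occupancy

/-- `Option C`, the type of outcomes of a dart on a set `C` of cells, is discrete. -/
instance optionMeasurableSpace {C : Type*} : MeasurableSpace (Option C) := ⊤

instance optionDiscreteMeasurableSpace {C : Type*} : DiscreteMeasurableSpace (Option C) :=
  ⟨fun _ => trivial⟩

/-- The set of cells that are hit by the first `n` outcomes; the outcome `none` is a miss. -/
def occupied {C : Type*} [DecidableEq C] (y : ℕ → Option C) (n : ℕ) : Finset C :=
  (Finset.range n).biUnion fun i => (y i).toFinset

/-- The probability that an outcome with law `ν` hits a cell outside `s`. -/
noncomputable def freeArea {C : Type*} (ν : Measure (Option C)) (s : Finset C) : ℝ :=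
  ν.real (some '' (s : Set C)ᶜ)

variable {Ω C : Type*} [MeasurableSpace Ω] {μ : Measure Ω}
  {ν : Measure (Option C)} {Y : ℕ → Ω → Option C}

theorem mul_le_freeArea [IsFiniteMeasure ν] {s T : Finset C} {a : ℝ}
    (ha : ∀ c ∈ T, a ≤ ν.real {some c}) (ha0 : 0 ≤ a) {r : ℕ} (hr : s.card + r ≤ T.card) :
    r * a ≤ freeArea ν s := by
  classical
  have hcard : r ≤ (T \ s).card := by
    have := Finset.le_card_sdiff s T
    omega
  calc r * a ≤ (T \ s).card * a := by gcongr
    _ ≤ ∑ c ∈ T \ s, ν.real {some c} := by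
        rw [← nsmul_eq_mul]
        exact Finset.card_nsmul_le_sum _ _ _ fun c hc => ha c (Finset.mem_sdiff.1 hc).1
    _ = ν.real (((T \ s).map .some : Finset (Option C)) : Set (Option C)) := by
        rw [← sum_measureReal_singleton, Finset.sum_map]
        rfl
    _ ≤ freeArea ν s := measureReal_mono fun o ho => by
        obtain ⟨c, hc, rfl⟩ := Finset.mem_map.1 (Finset.mem_coe.1 ho)
        exact ⟨c, (Finset.mem_sdiff.1 hc).2, rfl⟩

theorem hasSum_measureReal_some_image [Countable C] [IsFiniteMeasure ν] (A : Set C) :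
    HasSum (A.indicator fun c => ν.real {some c}) (ν.real (some '' A)) := by
  have hunion : some '' A = ⋃ c : A, {some (c : C)} := by
    ext o
    simp [eq_comm]
  have hdisj : Pairwise (Function.onFun Disjoint fun c : A => ({some (c : C)} : Set (Option C))) :=
    fun c d hcd => by simpa [Function.onFun, Subtype.ext_iff] using hcd
  rw [← hasSum_subtype_iff_indicator, measureReal_def, hunion,
    measure_iUnion hdisj fun _ => .of_discrete]
  have hfin : ∑' c : A, ν {some (c : C)} ≠ ⊤ := by
    rw [← measure_iUnion hdisj fun _ => .of_discrete]
    exact measure_ne_top _ _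
  rw [ENNReal.tsum_toReal_eq fun _ => measure_ne_top _ _]
  exact ENNReal.hasSum_toReal hfin

variable [DecidableEq C]

theorem occupied_succ (y : ℕ → Option C) (n : ℕ) :
    occupied y (n + 1) = occupied y n ∪ (y n).toFinset := by
  rw [occupied, Finset.range_add_one, Finset.biUnion_insert, Finset.union_comm, occupied]

theorem mem_occupied {y : ℕ → Option C} {n : ℕ} {c : C} :
    c ∈ occupied y n ↔ ∃ i < n, y i = some c := by
  simp [occupied]

theorem dependsOn_occupied (n : ℕ) :
    DependsOn (fun y : ℕ → Option C => occupied y n) (Set.Iio n) := fun y y' hyy' =>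
  Finset.biUnion_congr rfl fun i hi => by rw [hyy' i (Finset.mem_range.1 hi)]

theorem card_occupied_le (y : ℕ → Option C) (n : ℕ) : (occupied y n).card ≤ n := by
  simpa [occupied] using Finset.card_biUnion_le_card_mul (Finset.range n)
    (fun i => (y i).toFinset) 1 fun i _ => by cases y i <;> simp

theorem occupied_update_subset (y : ℕ → Option C) (n i : ℕ) (o : Option C) :
    occupied (Function.update y i o) n ⊆ occupied y n ∪ o.toFinset := by
  intro c hc
  obtain ⟨j, hj, hjc⟩ := mem_occupied.1 hc
  rcases eq_or_ne j i with rfl | hji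
  · rw [Function.update_self] at hjc
    simp [hjc]
  · rw [Function.update_of_ne hji] at hjc
    exact Finset.mem_union_left _ (mem_occupied.2 ⟨j, hj, hjc⟩)

theorem freeArea_le_add [IsFiniteMeasure ν] {s t : Finset C} {o : Option C}
    (hst : t ⊆ s ∪ o.toFinset) {a : ℝ} (ha : ∀ c, ν.real {some c} ≤ a) (ha0 : 0 ≤ a) :
    freeArea ν s ≤ freeArea ν t + a := by
  have hsub : some '' (s : Set C)ᶜ ⊆ some '' (t : Set C)ᶜ ∪ some '' {c | some c = o} := by
    rintro _ ⟨c, hc, rfl⟩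
    by_cases hct : c ∈ t
    · have : c ∈ s ∪ o.toFinset := hst hct
      simp_all
    · exact Or.inl ⟨c, hct, rfl⟩
  have hlast : ν.real (some '' {c | some c = o}) ≤ a := by
    cases o with
    | none => simpa using ha0
    | some c => simpa using ha c
  calc freeArea ν s ≤ ν.real (some '' (t : Set C)ᶜ ∪ some '' {c | some c = o}) :=
        measureReal_mono hsub
    _ ≤ freeArea ν t + ν.real (some '' {c | some c = o}) := measureReal_union_le _ _
    _ ≤ freeArea ν t + a := by gcongr

theorem abs_freeArea_occupied_update_sub_le [IsFiniteMeasure ν] {a : ℝ}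
    (ha : ∀ c, ν.real {some c} ≤ a) (ha0 : 0 ≤ a) (n i : ℕ) (y : ℕ → Option C) (o : Option C) :
    |freeArea ν (occupied (Function.update y i o) n) - freeArea ν (occupied y n)| ≤ a := by
  have hback := freeArea_le_add (occupied_update_subset (Function.update y i o) n i (y i)) ha ha0
  rw [Function.update_idem, Function.update_eq_self] at hback
  rw [abs_sub_le_iff]
  constructor <;> linarith [freeArea_le_add (occupied_update_subset y n i o) ha ha0]

theorem measureReal_notMem_occupied [IsProbabilityMeasure ν] (h : IsIIDSequence μ ν Y) (n : ℕ)
    (c : C) : μ.real {ω | c ∉ occupied (Y · ω) n} = (1 - ν.real {some c}) ^ n := by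
  have hset : {ω | c ∉ occupied (Y · ω) n} =
      {ω | ∀ i : Fin n, Y i ω ∈ ({some c} : Set (Option C))ᶜ} := by
    ext ω
    simp [mem_occupied, Fin.forall_iff]
  rw [hset, h.measureReal_forall_mem fun _ => .of_discrete, Finset.prod_const,
    Finset.card_univ, Fintype.card_fin, probReal_compl_eq_one_sub .of_discrete]

theorem measurableSet_setOf_occupied [Countable C] (h : IsIIDSequence μ ν Y) (n : ℕ)
    (p : Finset C → Prop) : MeasurableSet {ω | p (occupied (Y · ω) n)} :=
  measurableSet_setOfPred.2 <| h.measurable_of_dependsOn (f := fun y => p (occupied y n))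
    fun _ _ hyy' => congrArg p (dependsOn_occupied n hyy')

theorem integral_freeArea_occupied [Countable C] [IsProbabilityMeasure μ]
    (h : IsIIDSequence μ ν Y) (n : ℕ) :
    ∫ ω, freeArea ν (occupied (Y · ω) n) ∂μ =
      ∑' c, ν.real {some c} * (1 - ν.real {some c}) ^ n := by
  have := h.isProbabilityMeasure
  have hmeas (c : C) : MeasurableSet {ω | c ∉ occupied (Y · ω) n} :=
    measurableSet_setOf_occupied h n (c ∉ ·)
  set F : C → Ω → ℝ := fun c =>
    {ω | c ∉ occupied (Y · ω) n}.indicator fun _ => ν.real {some c}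
  have hF_nonneg (c : C) (ω : Ω) : 0 ≤ F c ω := Set.indicator_nonneg (fun _ _ => by positivity) ω
  have hF_integral (c : C) :
      ∫ ω, F c ω ∂μ = ν.real {some c} * (1 - ν.real {some c}) ^ n := by
    rw [integral_indicator_const _ (hmeas c), measureReal_notMem_occupied h, smul_eq_mul, mul_comm]
  have hsummable : Summable fun c => ∫ ω, ‖F c ω‖ ∂μ := by
    have hmass : Summable fun c : C => ν.real {some c} := by
      simpa using (hasSum_measureReal_some_image (ν := ν) (Set.univ : Set C)).summable
    refine hmass.of_nonneg_of_le (fun c => by positivity) fun c => ?_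
    simp only [Real.norm_of_nonneg (hF_nonneg c _), hF_integral]
    exact mul_le_of_le_one_right measureReal_nonneg
      (pow_le_one₀ (sub_nonneg.2 measureReal_le_one) (sub_le_self _ measureReal_nonneg))
  have hsum := hasSum_integral_of_summable_integral_norm
    (fun c => (integrable_const _).indicator (hmeas c)) hsummable
  rw [← tsum_congr hF_integral, hsum.tsum_eq]
  refine integral_congr_ae (ae_of_all _ fun ω => ?_)
  exact (hasSum_measureReal_some_image _).tsum_eq.symm

end Occupancy

section BoundedDifferences

open scoped NNReal

variable {Ω E : Type*}
theorem dependsOn_update_of_dependsOn_succ {β : Type*} {n : ℕ} {f : (ℕ → E) → β}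
    (hf : DependsOn f (Set.Iio (n + 1))) :
    DependsOn (fun y e => f (Function.update y n e)) (Set.Iio n) := fun y y' hyy' => by
  funext e
  refine hf fun i hi => ?_
  rcases eq_or_ne i n with rfl | hin
  · simp
  · simpa [hin] using hyy' i (Set.mem_Iio.2 (by simp only [Set.mem_Iio] at hi; omega))

theorem abs_sub_update_update_le {n i : ℕ} {f : (ℕ → E) → ℝ} {A : ℝ≥0}
    (hA : ∀ i y e, |f (Function.update y i e) - f y| ≤ A) (y : ℕ → E) (e e' : E) :
    |f (Function.update (Function.update y i e) n e') - f (Function.update y n e')| ≤ A := by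
  rcases eq_or_ne i n with rfl | hin
  · simp
  · rw [Function.update_comm hin]
    exact hA i _ e

theorem abs_sub_le_of_bounded_differences {n : ℕ} {f : (ℕ → E) → ℝ} (hf : DependsOn f (Set.Iio n))
    {A : ℝ≥0} (hA : ∀ i y e, |f (Function.update y i e) - f y| ≤ A) (y y' : ℕ → E) :
    |f y - f y'| ≤ n * A := by
  induction n generalizing f with
  | zero => simp [hf (x := y) (y := y') fun i hi => absurd hi (Nat.not_lt_zero i)]
  | succ n ih =>
    have hlast := hA n y (y' n)
    have hinit := ih (f := fun y => f (Function.update y n (y' n)))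
      (fun y z hyz => congrFun (dependsOn_update_of_dependsOn_succ hf hyz) (y' n))
      fun i y e => abs_sub_update_update_le hA y e (y' n)
    simp only [Function.update_eq_self] at hinit
    rw [abs_sub_comm] at hlast
    push_cast
    linarith [abs_sub_le (f y) (f (Function.update y n (y' n))) (f y')]

theorem exists_abs_le_of_bounded_differences [Nonempty E] {n : ℕ} {f : (ℕ → E) → ℝ}
    (hf : DependsOn f (Set.Iio n)) {A : ℝ≥0}
    (hA : ∀ i y e, |f (Function.update y i e) - f y| ≤ A) : ∃ B, ∀ y, |f y| ≤ B := by
  obtain ⟨y₀⟩ : Nonempty (ℕ → E) := inferInstance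
  refine ⟨n * A + |f y₀|, fun y => ?_⟩
  linarith [abs_sub_abs_le_abs_sub (f y) (f y₀), abs_sub_le_of_bounded_differences hf hA y y₀]

theorem exists_exp_mul_le_of_bounded_differences [Nonempty E] {n : ℕ} {f : (ℕ → E) → ℝ}
    (hf : DependsOn f (Set.Iio n)) {A : ℝ≥0}
    (hA : ∀ i y e, |f (Function.update y i e) - f y| ≤ A) (t : ℝ) :
    ∃ B, ∀ y, |Real.exp (t * f y)| ≤ B := by
  obtain ⟨B, hB⟩ := exists_abs_le_of_bounded_differences hf hA
  refine ⟨Real.exp (|t| * B), fun y => ?_⟩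
  rw [Real.abs_exp, Real.exp_le_exp]
  calc t * f y ≤ |t| * |f y| := (le_abs_self _).trans (abs_mul _ _).le
    _ ≤ |t| * B := by gcongr; exact hB y

variable [MeasurableSpace Ω] [MeasurableSpace E] {μ : Measure Ω} {ν : Measure E} {Y : ℕ → Ω → E}
  [Countable E] [DiscreteMeasurableSpace E]

theorem hasSubgaussianMGF_update_sub_integral [IsProbabilityMeasure ν] {n : ℕ}
    {f : (ℕ → E) → ℝ} {A : ℝ≥0} (hA : ∀ i y e, |f (Function.update y i e) - f y| ≤ A)
    (y : ℕ → E) :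
    HasSubgaussianMGF (fun e => f (Function.update y n e) - ∫ e, f (Function.update y n e) ∂ν)
      ((A / 2) ^ 2) ν := by
  set g : E → ℝ := fun e => f (Function.update y n e)
  have hg (e e' : E) : |g e - g e'| ≤ A := by
    have := hA n (Function.update y n e') e
    rwa [Function.update_idem] at this
  have hbdd : BddBelow (Set.range g) :=
    ⟨g (y n) - A, Set.forall_mem_range.2 fun e => by linarith [abs_le.1 (hg e (y n))]⟩
  have : Nonempty E := ⟨y n⟩
  have hmem (e : E) : g e ∈ Set.Icc (⨅ e, g e) ((⨅ e, g e) + A) := by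
    refine ⟨ciInf_le hbdd e, ?_⟩
    have := le_ciInf fun e' => show g e - A ≤ g e' by linarith [(abs_le.1 (hg e e')).2]
    linarith
  simpa using hasSubgaussianMGF_of_mem_Icc (μ := ν) (measurable_of_countable g).aemeasurable
    (ae_of_all _ hmem)

theorem integrable_update [IsProbabilityMeasure ν] {n : ℕ} {f : (ℕ → E) → ℝ} {A : ℝ≥0}
    (hA : ∀ i y e, |f (Function.update y i e) - f y| ≤ A) (y : ℕ → E) :
    Integrable (fun e => f (Function.update y n e)) ν := by
  have hsub := (hasSubgaussianMGF_update_sub_integral (ν := ν) (n := n) hA y).integrable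
  exact (hsub.add (integrable_const _)).congr (ae_of_all _ fun e => sub_add_cancel _ _)

theorem mgf_update_le [IsProbabilityMeasure ν] {n : ℕ} {f : (ℕ → E) → ℝ} {A : ℝ≥0}
    (hA : ∀ i y e, |f (Function.update y i e) - f y| ≤ A) (y : ℕ → E) (t : ℝ) :
    mgf (fun e => f (Function.update y n e)) ν t ≤
      Real.exp (t * ∫ e, f (Function.update y n e) ∂ν) *
        Real.exp ((A / 2) ^ 2 * t ^ 2 / 2) := by
  set c := ∫ e, f (Function.update y n e) ∂ν
  calc mgf (fun e => f (Function.update y n e)) ν t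
      = Real.exp (t * c) * mgf (fun e => f (Function.update y n e) - c) ν t := by
        rw [← mgf_const_add]
        simp only [add_sub_cancel]
    _ ≤ Real.exp (t * c) * Real.exp ((A / 2) ^ 2 * t ^ 2 / 2) := by
        gcongr
        exact (hasSubgaussianMGF_update_sub_integral hA y).mgf_le t

theorem abs_integral_update_sub_le [IsProbabilityMeasure ν] {n i : ℕ} {f : (ℕ → E) → ℝ} {A : ℝ≥0}
    (hA : ∀ i y e, |f (Function.update y i e) - f y| ≤ A) (y : ℕ → E) (e : E) :
    |∫ e', f (Function.update (Function.update y i e) n e') ∂ν -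
      ∫ e', f (Function.update y n e') ∂ν| ≤ A := by
  rw [← integral_sub (integrable_update hA _) (integrable_update hA _)]
  have hbound (e' : E) : ‖f (Function.update (Function.update y i e) n e') -
      f (Function.update y n e')‖ ≤ A := abs_sub_update_update_le hA y e e'
  simpa using norm_integral_le_of_norm_le_const (μ := ν) (ae_of_all _ hbound)

namespace IsIIDSequence

theorem integrable_exp_mul_of_bounded_differences [IsProbabilityMeasure μ]
    (h : IsIIDSequence μ ν Y) {n : ℕ} {f : (ℕ → E) → ℝ} (hf : DependsOn f (Set.Iio n)) {A : ℝ≥0}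
    (hA : ∀ i y e, |f (Function.update y i e) - f y| ≤ A) (t : ℝ) :
    Integrable (fun ω => Real.exp (t * f (Y · ω))) μ := by
  obtain ⟨ω₀⟩ := μ.nonempty_of_neZero
  have : Nonempty E := ⟨Y 0 ω₀⟩
  obtain ⟨B, hB⟩ := exists_exp_mul_le_of_bounded_differences hf hA t
  exact h.integrable_of_dependsOn (f := fun y => Real.exp (t * f y))
    (fun _ _ hyz => congrArg (fun c => Real.exp (t * c)) (hf hyz)) hB

theorem integral_eq_integral_integral_update [IsProbabilityMeasure μ] (h : IsIIDSequence μ ν Y)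
    {n : ℕ} {f : (ℕ → E) → ℝ} (hf : DependsOn f (Set.Iio (n + 1))) {A : ℝ≥0}
    (hA : ∀ i y e, |f (Function.update y i e) - f y| ≤ A) :
    ∫ ω, f (Y · ω) ∂μ = ∫ ω, ∫ e, f (Function.update (Y · ω) n e) ∂ν ∂μ := by
  obtain ⟨ω₀⟩ := μ.nonempty_of_neZero
  have : Nonempty E := ⟨Y 0 ω₀⟩
  obtain ⟨B, hB⟩ := exists_abs_le_of_bounded_differences hf hA
  rw [← h.integral_dependsOn_apply (dependsOn_update_of_dependsOn_succ hf) fun y e => hB _]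
  simp only [Function.update_eq_self]

theorem mgf_eq_integral_mgf_update [IsProbabilityMeasure μ] (h : IsIIDSequence μ ν Y)
    (t : ℝ) {n : ℕ} {f : (ℕ → E) → ℝ} (hf : DependsOn f (Set.Iio (n + 1))) {A : ℝ≥0}
    (hA : ∀ i y e, |f (Function.update y i e) - f y| ≤ A) :
    mgf (fun ω => f (Y · ω)) μ t =
      ∫ ω, mgf (fun e => f (Function.update (Y · ω) n e)) ν t ∂μ := by
  obtain ⟨ω₀⟩ := μ.nonempty_of_neZero
  have : Nonempty E := ⟨Y 0 ω₀⟩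
  obtain ⟨B, hB⟩ := exists_exp_mul_le_of_bounded_differences hf hA t
  refine Eq.trans ?_ (h.integral_dependsOn_apply
    (fun _ _ hyz =>
      congrArg (fun F e => Real.exp (t * F e)) (dependsOn_update_of_dependsOn_succ hf hyz))
    fun y e => hB (Function.update y n e))
  simp only [mgf, Function.update_eq_self]

theorem mgf_le_of_bounded_differences [IsProbabilityMeasure μ] (h : IsIIDSequence μ ν Y)
    (t : ℝ) {n : ℕ} {f : (ℕ → E) → ℝ} (hf : DependsOn f (Set.Iio n)) {A : ℝ≥0}
    (hA : ∀ i y e, |f (Function.update y i e) - f y| ≤ A) :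
    mgf (fun ω => f (Y · ω)) μ t ≤
      Real.exp (t * ∫ ω, f (Y · ω) ∂μ) * Real.exp (n * (A / 2) ^ 2 * t ^ 2 / 2) := by
  have := h.isProbabilityMeasure
  obtain ⟨ω₀⟩ := μ.nonempty_of_neZero
  induction n generalizing f with
  | zero =>
    have hconst (ω : Ω) : f (Y · ω) = f (Y · ω₀) :=
      hf fun i hi => absurd hi (Nat.not_lt_zero i)
    simp [mgf, hconst]
  | succ n ih =>
    set g : (ℕ → E) → ℝ := fun y => ∫ e, f (Function.update y n e) ∂ν
    have hg : DependsOn g (Set.Iio n) := fun y z hyz => by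
      simp only [g, dependsOn_update_of_dependsOn_succ hf hyz]
    have hgA (i : ℕ) (y : ℕ → E) (e : E) : |g (Function.update y i e) - g y| ≤ A :=
      abs_integral_update_sub_le hA y e
    have hmean : ∫ ω, f (Y · ω) ∂μ = ∫ ω, g (Y · ω) ∂μ :=
      h.integral_eq_integral_integral_update hf hA
    calc mgf (fun ω => f (Y · ω)) μ t
        = ∫ ω, mgf (fun e => f (Function.update (Y · ω) n e)) ν t ∂μ :=
          h.mgf_eq_integral_mgf_update t hf hA
      _ ≤ ∫ ω, Real.exp (t * g (Y · ω)) * Real.exp ((A / 2) ^ 2 * t ^ 2 / 2) ∂μ := by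
          refine integral_mono_of_nonneg (ae_of_all _ fun ω => mgf_nonneg)
            ((h.integrable_exp_mul_of_bounded_differences hg hgA t).mul_const _)
            (ae_of_all _ fun ω => mgf_update_le hA _ t)
      _ = mgf (fun ω => g (Y · ω)) μ t * Real.exp ((A / 2) ^ 2 * t ^ 2 / 2) :=
          integral_mul_const _ _
      _ ≤ Real.exp (t * ∫ ω, g (Y · ω) ∂μ) * Real.exp (n * (A / 2) ^ 2 * t ^ 2 / 2) *
            Real.exp ((A / 2) ^ 2 * t ^ 2 / 2) := by gcongr; exact ih hg hgA
      _ = _ := by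
          rw [hmean, mul_assoc, ← Real.exp_add]
          push_cast
          ring_nf

theorem hasSubgaussianMGF_sub_integral [IsProbabilityMeasure μ]
    (h : IsIIDSequence μ ν Y) {n : ℕ} {f : (ℕ → E) → ℝ} (hf : DependsOn f (Set.Iio n)) {A : ℝ≥0}
    (hA : ∀ i y e, |f (Function.update y i e) - f y| ≤ A) :
    HasSubgaussianMGF (fun ω => f (Y · ω) - ∫ ω, f (Y · ω) ∂μ) (n * (A / 2) ^ 2) μ where
  integrable_exp_mul t := by
    refine ((h.integrable_exp_mul_of_bounded_differences hf hA t).mul_const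
      (Real.exp (t * -∫ ω, f (Y · ω) ∂μ))).congr (ae_of_all _ fun ω => ?_)
    simp only [← Real.exp_add, ← mul_add, sub_eq_add_neg]
  mgf_le t := by
    simp only [sub_eq_add_neg, mgf_add_const]
    calc mgf (fun ω => f (Y · ω)) μ t * Real.exp (t * -∫ ω, f (Y · ω) ∂μ)
        ≤ Real.exp (t * ∫ ω, f (Y · ω) ∂μ) * Real.exp (n * (A / 2) ^ 2 * t ^ 2 / 2) *
            Real.exp (t * -∫ ω, f (Y · ω) ∂μ) := by
          gcongr
          exact h.mgf_le_of_bounded_differences t hf hA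
      _ = Real.exp (n * (A / 2) ^ 2 * t ^ 2 / 2) := by
          rw [← Real.exp_add, ← Real.exp_add]
          ring_nf

end IsIIDSequence

theorem hasSubgaussianMGF_mono {X : Ω → ℝ} {c d : ℝ≥0} (hX : HasSubgaussianMGF X c μ)
    (hcd : c ≤ d) : HasSubgaussianMGF X d μ where
  integrable_exp_mul := hX.integrable_exp_mul
  mgf_le t := (hX.mgf_le t).trans (by gcongr)

theorem measureReal_le_abs_of_hasSubgaussianMGF [IsFiniteMeasure μ] {X : Ω → ℝ} {c : ℝ≥0}
    (hX : HasSubgaussianMGF X c μ) {ε : ℝ} (hε : 0 ≤ ε) :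
    μ.real {ω | ε ≤ |X ω|} ≤ 2 * Real.exp (-ε ^ 2 / (2 * c)) := by
  have hset : {ω | ε ≤ |X ω|} = {ω | ε ≤ X ω} ∪ {ω | ε ≤ (-X) ω} := by
    ext ω
    simp [le_abs]
  rw [hset, two_mul]
  exact (measureReal_union_le _ _).trans (add_le_add (hX.measure_ge_le hε)
    (hX.neg.measure_ge_le hε))

theorem ae_tendsto_zero_of_hasSubgaussianMGF [IsFiniteMeasure μ] {X : ℕ → Ω → ℝ} {c : ℕ → ℝ≥0}
    (hX : ∀ᶠ m in atTop, HasSubgaussianMGF (X m) (c m) μ) {K : ℝ≥0}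
    (hc : ∀ᶠ m in atTop, c m ≤ K / m) :
    ∀ᵐ ω ∂μ, Tendsto (fun m => X m ω) atTop (𝓝 0) := by
  have htail {ε : ℝ} (hε : 0 < ε) : ∀ᵐ ω ∂μ, ∀ᶠ m in atTop, |X m ω| < ε := by
    have hprob : ∀ᶠ m : ℕ in atTop, ‖μ.real {ω | ε ≤ |X m ω|}‖ ≤
        2 * Real.exp (-(ε ^ 2 / (2 * (K + 1)))) ^ m := by
      filter_upwards [hX, hc, eventually_gt_atTop 0] with m hXm hcm hm
      have hcm' : c m ≤ (K + 1) / m := hcm.trans (by gcongr; simp)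
      rw [Real.norm_of_nonneg measureReal_nonneg]
      refine (measureReal_le_abs_of_hasSubgaussianMGF (hasSubgaussianMGF_mono hXm hcm')
        hε.le).trans_eq ?_
      rw [← Real.exp_nat_mul]
      push_cast
      congr 2
      field_simp
    have hsum : Summable fun m => μ.real {ω | ε ≤ |X m ω|} :=
      .of_norm_bounded_eventually_nat ((summable_geometric_of_lt_one (Real.exp_nonneg _)
        (Real.exp_lt_one_iff.2 (neg_lt_zero.2 (by positivity)))).mul_left 2) hprob
    filter_upwards [ae_eventually_notMem (μ := μ) (s := fun m => {ω | ε ≤ |X m ω|})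
      (by simpa using hsum.tsum_ofReal_ne_top)] with ω hω
    simpa using hω
  have hall : ∀ᵐ ω ∂μ, ∀ k : ℕ, ∀ᶠ m in atTop, |X m ω| < 1 / (k + 1 : ℝ) :=
    ae_all_iff.2 fun k => htail Nat.one_div_pos_of_nat
  filter_upwards [hall] with ω hω
  rw [Metric.tendsto_nhds]
  intro ε hε
  obtain ⟨k, hk⟩ := exists_nat_one_div_lt hε
  filter_upwards [hω k] with m hm
  simpa using hm.trans hk

end BoundedDifferences

section MartingaleEstimator

namespace IsIIDSequence

theorem variance_add_apply {Ω E : Type*} [MeasurableSpace Ω] [MeasurableSpace E] [Countable E]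
    [DiscreteMeasurableSpace E] {μ : Measure Ω} [IsProbabilityMeasure μ] {ν : Measure E}
    {Y : ℕ → Ω → E} (h : IsIIDSequence μ ν Y) {n : ℕ} {M : (ℕ → E) → ℝ} {D : (ℕ → E) → E → ℝ}
    (hM : DependsOn M (Set.Iio n)) (hD : DependsOn D (Set.Iio n)) {A B : ℝ}
    (hMA : ∀ y, |M y| ≤ A) (hDB : ∀ y e, |D y e| ≤ B) (hD0 : ∀ y, ∫ e, D y e ∂ν = 0) :
    Var[fun ω => M (Y · ω) + D (Y · ω) (Y n ω); μ] =
      Var[fun ω => M (Y · ω); μ] + ∫ ω, ∫ e, D (Y · ω) e ^ 2 ∂ν ∂μ := by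
  have hDsq (y : ℕ → E) (e : E) : |D y e ^ 2| ≤ B ^ 2 := by
    rw [abs_pow]
    exact pow_le_pow_left₀ (abs_nonneg _) (hDB y e) 2
  have hMD (y : ℕ → E) (e : E) : |M y * D y e| ≤ A * B := by
    rw [abs_mul]
    exact mul_le_mul (hMA y) (hDB y e) (abs_nonneg _) ((abs_nonneg _).trans (hMA y))
  have hDn : DependsOn (fun y : ℕ → E => D y (y n)) (Set.Iio (n + 1)) := fun y y' hyy' => by
    have hD' : D y = D y' := hD fun i hi => hyy' i (Set.mem_Iio.2 (Nat.lt_succ_of_lt hi))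
    simp only [hD', hyy' n (Set.mem_Iio.2 n.lt_succ_self)]
  have hM2 : MemLp (fun ω => M (Y · ω)) 2 μ :=
    .of_bound (h.measurable_of_dependsOn hM).aestronglyMeasurable A (ae_of_all _ fun _ => hMA _)
  have hD2 : MemLp (fun ω => D (Y · ω) (Y n ω)) 2 μ :=
    .of_bound (h.measurable_of_dependsOn hDn).aestronglyMeasurable B (ae_of_all _ fun _ => hDB _ _)
  have hmean : ∫ ω, D (Y · ω) (Y n ω) ∂μ = 0 := by
    simp [h.integral_dependsOn_apply hD hDB, hD0]
  have hcov : cov[fun ω => M (Y · ω), fun ω => D (Y · ω) (Y n ω); μ] = 0 := by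
    have hprod := h.integral_dependsOn_apply (n := n)
      (G := fun y e => M y * D y e) (fun y y' hyy' => by simp only [hM hyy', hD hyy']) hMD
    rw [covariance_eq_sub hM2 hD2, hmean, mul_zero, sub_zero]
    exact hprod.trans (by simp [integral_const_mul, hD0])
  rw [variance_fun_add hM2 hD2, hcov, variance_of_integral_eq_zero hD2.aemeasurable hmean,
    mul_zero, add_zero]
  exact congrArg _ (h.integral_dependsOn_apply (G := fun y e => D y e ^ 2)
    (fun y y' hyy' => by simp only [hD hyy']) hDsq)

end IsIIDSequence

theorem abs_indicator_inv_sub_one_le {E : Type*} {N : Set E} {δ a : ℝ} (hδ : 0 < δ) (ha : δ ≤ a)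
    (e : E) : |N.indicator (fun _ => 1 / a) e - 1| ≤ 1 / δ + 1 := by
  refine (abs_sub _ _).trans (add_le_add ?_ abs_one.le)
  have hinv := one_div_le_one_div_of_le hδ ha
  have hpos := one_div_pos.2 (hδ.trans_le ha)
  by_cases he : e ∈ N
  · rwa [Set.indicator_of_mem he, abs_of_pos hpos]
  · rw [Set.indicator_of_notMem he, abs_zero]
    exact (hpos.trans_le hinv).le

theorem integral_indicator_inv_sub_one {E : Type*} [MeasurableSpace E] {ν : Measure E}
    [IsProbabilityMeasure ν] {N : Set E} (hN : MeasurableSet N) (hN0 : ν.real N ≠ 0) :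
    ∫ e, (N.indicator (fun _ => 1 / ν.real N) e - 1) ∂ν = 0 := by
  rw [integral_sub ((integrable_const _).indicator hN) (integrable_const _),
    integral_indicator_const _ hN]
  simp [hN0]

theorem integral_indicator_inv_sub_one_sq {E : Type*} [MeasurableSpace E] {ν : Measure E}
    [IsProbabilityMeasure ν] {N : Set E} (hN : MeasurableSet N) (hN0 : ν.real N ≠ 0) :
    ∫ e, (N.indicator (fun _ => 1 / ν.real N) e - 1) ^ 2 ∂ν = 1 / ν.real N - 1 := by
  have hsq (e : E) : (N.indicator (fun _ => 1 / ν.real N) e - 1) ^ 2 =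
      N.indicator (fun _ => (1 / ν.real N) ^ 2 - 2 / ν.real N) e + 1 := by
    by_cases he : e ∈ N <;> simp [he]
    ring
  simp only [hsq]
  rw [integral_add ((integrable_const _).indicator hN) (integrable_const _),
    integral_indicator_const _ hN]
  simp only [smul_eq_mul, integral_const, probReal_univ]
  field_simp
  ring

/-- The martingale estimator, as a function of the sequence of cells that are hit. -/
noncomputable def estimate {C : Type*} [DecidableEq C] (ν : Measure (Option C))
    (y : ℕ → Option C) (n : ℕ) : ℝ :=
  ∑ k ∈ Finset.range n,
    if occupied y (k + 1) ≠ occupied y k then 1 / freeArea ν (occupied y k) else 0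

variable {Ω C : Type*} [MeasurableSpace Ω] {μ : Measure Ω} {ν : Measure (Option C)}
  {Y : ℕ → Ω → Option C} [DecidableEq C]

theorem union_toFinset_ne_iff {s : Finset C} {o : Option C} :
    s ∪ o.toFinset ≠ s ↔ o ∈ some '' (s : Set C)ᶜ := by
  cases o <;> simp

theorem estimate_succ (y : ℕ → Option C) (n : ℕ) :
    estimate ν y (n + 1) = estimate ν y n +
      (some '' (occupied y n : Set C)ᶜ).indicator
        (fun _ => 1 / freeArea ν (occupied y n)) (y n) := by
  classical
  rw [estimate, Finset.sum_range_succ, ← estimate, occupied_succ, Set.indicator_apply]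
  simp only [union_toFinset_ne_iff]

theorem dependsOn_estimate (n : ℕ) :
    DependsOn (fun y : ℕ → Option C => estimate ν y n) (Set.Iio n) := fun y y' hyy' => by
  refine Finset.sum_congr rfl fun k hk => ?_
  have hoccupied {j : ℕ} (hj : j ≤ n) : occupied y j = occupied y' j :=
    (dependsOn_occupied j).mono (Set.Iio_subset_Iio hj) hyy'
  have hkn := Finset.mem_range.1 hk
  rw [hoccupied hkn, hoccupied hkn.le]

theorem abs_estimate_le {δ : ℝ} (hδ : 0 < δ) {n : ℕ}
    (hF : ∀ s : Finset C, s.card < n → δ ≤ freeArea ν s) (y : ℕ → Option C) :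
    |estimate ν y n| ≤ n * (1 / δ) := by
  refine (Finset.abs_sum_le_sum_abs _ _).trans ?_
  refine (Finset.sum_le_card_nsmul _ _ (1 / δ) fun k hk => ?_).trans_eq (by simp)
  have hFk : δ ≤ freeArea ν (occupied y k) :=
    hF _ ((card_occupied_le y k).trans_lt (Finset.mem_range.1 hk))
  split_ifs
  · rw [abs_of_nonneg (one_div_nonneg.2 (hδ.le.trans hFk))]
    exact one_div_le_one_div_of_le hδ hFk
  · simpa using hδ.le

namespace IsIIDSequence

variable [Countable C] [IsProbabilityMeasure μ]

theorem memLp_estimate (h : IsIIDSequence μ ν Y) {δ : ℝ} (hδ : 0 < δ) {n : ℕ}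
    (hF : ∀ s : Finset C, s.card < n → δ ≤ freeArea ν s) :
    MemLp (fun ω => estimate ν (Y · ω) n) 2 μ :=
  .of_bound (h.measurable_of_dependsOn (dependsOn_estimate n)).aestronglyMeasurable
    (n * (1 / δ)) (ae_of_all _ fun _ => abs_estimate_le hδ hF _)

theorem integrable_one_div_freeArea (h : IsIIDSequence μ ν Y) {δ : ℝ} (hδ : 0 < δ) {n k : ℕ}
    (hF : ∀ s : Finset C, s.card < n → δ ≤ freeArea ν s) (hk : k < n) :
    Integrable (fun ω => 1 / freeArea ν (occupied (Y · ω) k)) μ := by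
  refine h.integrable_of_dependsOn (f := fun y => 1 / freeArea ν (occupied y k))
    (fun _ _ hyy' => congrArg (1 / freeArea ν ·) (dependsOn_occupied k hyy')) (B := 1 / δ)
    fun y => ?_
  have hFk := hF _ ((card_occupied_le y k).trans_lt hk)
  rw [abs_of_nonneg (one_div_nonneg.2 (hδ.le.trans hFk))]
  exact one_div_le_one_div_of_le hδ hFk

/-- Given the first `n` outcomes, the increment of the estimator has mean `1` and variance
`1 / freeArea - 1`. -/
theorem variance_estimate_succ (h : IsIIDSequence μ ν Y) {δ : ℝ} (hδ : 0 < δ) {n : ℕ}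
    (hF : ∀ s : Finset C, s.card < n + 1 → δ ≤ freeArea ν s) :
    Var[fun ω => estimate ν (Y · ω) (n + 1); μ] =
      Var[fun ω => estimate ν (Y · ω) n; μ] +
        (∫ ω, 1 / freeArea ν (occupied (Y · ω) n) ∂μ - 1) := by
  have := h.isProbabilityMeasure
  have hF' (s : Finset C) (hs : s.card < n) := hF s (hs.trans n.lt_succ_self)
  have hFn (y : ℕ → Option C) : δ ≤ freeArea ν (occupied y n) :=
    hF _ ((card_occupied_le y n).trans_lt n.lt_succ_self)
  set D : (ℕ → Option C) → Option C → ℝ := fun y o =>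
    (some '' (occupied y n : Set C)ᶜ).indicator (fun _ => 1 / freeArea ν (occupied y n)) o - 1
  have hD : DependsOn D (Set.Iio n) := fun y y' hyy' => by
    simp only [D, (dependsOn_occupied n hyy' : occupied y n = occupied y' n)]
  have hDB (y : ℕ → Option C) (o : Option C) : |D y o| ≤ 1 / δ + 1 :=
    abs_indicator_inv_sub_one_le hδ (hFn y) o
  have hM : DependsOn (fun y : ℕ → Option C => estimate ν y n + 1) (Set.Iio n) :=
    fun y y' hyy' => congrArg (· + 1) (dependsOn_estimate n hyy')
  have hMA (y : ℕ → Option C) : |estimate ν y n + 1| ≤ n * (1 / δ) + 1 :=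
    (abs_add_le _ _).trans (add_le_add (abs_estimate_le hδ hF' y) abs_one.le)
  have hF0 (y : ℕ → Option C) : freeArea ν (occupied y n) ≠ 0 := (hδ.trans_le (hFn y)).ne'
  have hadd := h.variance_add_apply (M := fun y => estimate ν y n + 1) hM hD hMA hDB fun y =>
    integral_indicator_inv_sub_one .of_discrete (hF0 y)
  calc Var[fun ω => estimate ν (Y · ω) (n + 1); μ]
      = Var[fun ω => (estimate ν (Y · ω) n + 1) + D (Y · ω) (Y n ω); μ] := by
        simp only [estimate_succ, D, add_add_sub_cancel]
    _ = Var[fun ω => estimate ν (Y · ω) n + 1; μ] + ∫ ω, ∫ o, D (Y · ω) o ^ 2 ∂ν ∂μ :=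
        hadd
    _ = Var[fun ω => estimate ν (Y · ω) n; μ] +
          ∫ ω, (1 / freeArea ν (occupied (Y · ω) n) - 1) ∂μ := by
        rw [variance_add_const (memLp_estimate h hδ hF').aestronglyMeasurable]
        exact congrArg _ (integral_congr_ae (ae_of_all _ fun ω =>
          integral_indicator_inv_sub_one_sq .of_discrete (hF0 (Y · ω))))
    _ = _ := by
        rw [integral_sub (h.integrable_one_div_freeArea hδ hF n.lt_succ_self)
          (integrable_const _)]
        simp

theorem variance_estimate (h : IsIIDSequence μ ν Y) {δ : ℝ} (hδ : 0 < δ) {n : ℕ}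
    (hF : ∀ s : Finset C, s.card < n → δ ≤ freeArea ν s) :
    Var[fun ω => estimate ν (Y · ω) n; μ] =
      ∑ k ∈ Finset.range n, (∫ ω, 1 / freeArea ν (occupied (Y · ω) k) ∂μ - 1) := by
  induction n with
  | zero =>
    simp only [estimate, Finset.range_zero, Finset.sum_empty]
    exact variance_zero μ
  | succ n ih =>
    rw [h.variance_estimate_succ hδ hF, ih fun s hs => hF s (hs.trans n.lt_succ_self),
      Finset.sum_range_succ]

end IsIIDSequence

end MartingaleEstimator

section SplitEntropy

open Real

/-- The entropy gained by splitting an atom of mass `x + y` into atoms of masses `x` and `y`. -/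
noncomputable def splitEntropy (x y : ℝ) : ℝ := negMulLog x + negMulLog y - negMulLog (x + y)

theorem splitEntropy_zero : splitEntropy 0 0 = 0 := by simp [splitEntropy]

theorem splitEntropy_one_sub (p : ℝ) : splitEntropy p (1 - p) = binEntropy p := by
  simp [splitEntropy, binEntropy_eq_negMulLog_add_negMulLog_one_sub]

theorem splitEntropy_eq_mul_binEntropy {x y : ℝ} (hxy : 0 < x + y) :
    splitEntropy x y = (x + y) * binEntropy (x / (x + y)) := by
  have hx : (x + y) * (x / (x + y)) = x := mul_div_cancel₀ _ hxy.ne'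
  have hy : (x + y) * (1 - x / (x + y)) = y := by rw [mul_sub, hx]; ring
  have hnx := negMulLog_mul (x + y) (x / (x + y))
  have hny := negMulLog_mul (x + y) (1 - x / (x + y))
  rw [hx] at hnx
  rw [hy] at hny
  rw [splitEntropy, binEntropy_eq_negMulLog_add_negMulLog_one_sub, hnx, hny]
  ring

theorem splitEntropy_add_le {x y x' y' : ℝ} (hx : 0 ≤ x) (hy : 0 ≤ y) (hx' : 0 ≤ x')
    (hy' : 0 ≤ y') : splitEntropy x y + splitEntropy x' y' ≤ splitEntropy (x + x') (y + y') := by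
  rcases (add_nonneg hx hy).eq_or_lt with h | h
  · obtain ⟨rfl, rfl⟩ : x = 0 ∧ y = 0 := ⟨by linarith, by linarith⟩
    simp [splitEntropy_zero]
  rcases (add_nonneg hx' hy').eq_or_lt with h' | h'
  · obtain ⟨rfl, rfl⟩ : x' = 0 ∧ y' = 0 := ⟨by linarith, by linarith⟩
    simp [splitEntropy_zero]
  have hs : 0 < (x + x') + (y + y') := by linarith
  rw [splitEntropy_eq_mul_binEntropy h, splitEntropy_eq_mul_binEntropy h',
    splitEntropy_eq_mul_binEntropy hs]
  have hmem {u v : ℝ} (hu : 0 ≤ u) (hv : 0 ≤ v) (huv : 0 < u + v) :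
      u / (u + v) ∈ Set.Icc (0 : ℝ) 1 :=
    ⟨div_nonneg hu huv.le, (div_le_one huv).2 (by linarith)⟩
  have hconcave := strictConcave_binEntropy.concaveOn.2 (hmem hx hy h) (hmem hx' hy' h')
    (div_nonneg h.le hs.le) (div_nonneg h'.le hs.le) (by field_simp; ring)
  have hmean : (x + y) / ((x + x') + (y + y')) * (x / (x + y)) +
      (x' + y') / ((x + x') + (y + y')) * (x' / (x' + y')) =
      (x + x') / ((x + x') + (y + y')) := by
    field_simp
  simp only [smul_eq_mul, hmean] at hconcave
  refine le_trans (le_of_eq ?_) (mul_le_mul_of_nonneg_left hconcave hs.le)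
  field_simp

theorem sum_splitEntropy_le {ι : Type*} (U : Finset ι) {x y : ι → ℝ} (hx : ∀ i, 0 ≤ x i)
    (hy : ∀ i, 0 ≤ y i) :
    ∑ i ∈ U, splitEntropy (x i) (y i) ≤ splitEntropy (∑ i ∈ U, x i) (∑ i ∈ U, y i) := by
  classical
  induction U using Finset.induction_on with
  | empty => simp [splitEntropy_zero]
  | insert i U hi ih =>
    simp only [Finset.sum_insert hi]
    exact (add_le_add_right ih _).trans (splitEntropy_add_le (hx i) (hy i)
      (Finset.sum_nonneg fun j _ => hx j) (Finset.sum_nonneg fun j _ => hy j))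

/-- By `log u ≤ u - 1`, the Kullback-Leibler divergence is at most the `χ²`-divergence. -/
theorem le_splitEntropy {x y q : ℝ} (hx : 0 ≤ x) (hy : 0 ≤ y) (hq0 : 0 < q) (hq1 : q < 1) :
    x * -log q + y * -log (1 - q) -
      (x ^ 2 / (x + y) - 2 * q * x + q ^ 2 * (x + y)) / (q * (1 - q)) ≤ splitEntropy x y := by
  have h1q := sub_pos.2 hq1
  rcases (add_nonneg hx hy).eq_or_lt with ht | ht
  · obtain ⟨rfl, rfl⟩ : x = 0 ∧ y = 0 := ⟨by linarith, by linarith⟩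
    simp [splitEntropy_zero]
  have hmass {u r : ℝ} (hu : 0 ≤ u) (hr : 0 < r) :
      u * -log r - (u ^ 2 / ((x + y) * r) - u) ≤ negMulLog u + u * log (x + y) := by
    rcases hu.eq_or_lt with rfl | hu
    · simp
    have hlog := log_le_sub_one_of_pos (div_pos hu (mul_pos ht hr))
    rw [log_div hu.ne' (mul_pos ht hr).ne', log_mul ht.ne' hr.ne'] at hlog
    have hmul := mul_le_mul_of_nonneg_left hlog hu.le
    rw [mul_sub u (u / _), ← mul_div_assoc, ← pow_two] at hmul
    rw [negMulLog]
    linarith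
  have hchi : x ^ 2 / ((x + y) * q) - x + (y ^ 2 / ((x + y) * (1 - q)) - y) =
      (x ^ 2 / (x + y) - 2 * q * x + q ^ 2 * (x + y)) / (q * (1 - q)) := by
    field_simp
    ring
  have hneg : negMulLog (x + y) = -(x * log (x + y) + y * log (x + y)) := by
    rw [negMulLog]
    ring
  rw [← hchi, splitEntropy, hneg]
  linarith [hmass hx hq0, hmass hy h1q]

end SplitEntropy

section Entropy

open Real

variable {Ω β γ C : Type*} [MeasurableSpace Ω] {μ : Measure Ω}

theorem sum_measureReal_preimage_singleton_inter [IsFiniteMeasure μ] {Z : Ω → β}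
    (hZ : ∀ z, MeasurableSet (Z ⁻¹' {z})) (U : Finset β) (E : Set Ω) :
    ∑ z ∈ U, μ.real (Z ⁻¹' {z} ∩ E) = μ.real (Z ⁻¹' U ∩ E) := by
  have hU : MeasurableSet (Z ⁻¹' (U : Set β)) := by
    rw [← Set.biUnion_preimage_singleton]
    exact U.measurableSet_biUnion fun z _ => hZ z
  simp only [← measureReal_restrict_apply (hZ _), ← measureReal_restrict_apply hU]
  exact sum_measureReal_preimage_singleton U fun z _ => hZ z

/-- The conditional entropy of the indicator of the event `D` given a random variable `Z` with
values in the finite set `U`. -/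
noncomputable def condEntropy (μ : Measure Ω) (Z : Ω → β) (U : Finset β) (D : Set Ω) : ℝ :=
  ∑ z ∈ U, splitEntropy (μ.real (Z ⁻¹' {z} ∩ D)) (μ.real (Z ⁻¹' {z} ∩ Dᶜ))

theorem condEntropy_le_condEntropy_comp [IsFiniteMeasure μ] {Z : Ω → β}
    (hZ : ∀ z, MeasurableSet (Z ⁻¹' {z})) {U : Finset β} (hU : ∀ ω, Z ω ∈ U) {f : β → γ}
    {V : Finset γ} (hf : ∀ z ∈ U, f z ∈ V) (D : Set Ω) :
    condEntropy μ Z U D ≤ condEntropy μ (f ∘ Z) V D := by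
  classical
  rw [condEntropy, ← Finset.sum_fiberwise_of_maps_to hf]
  refine Finset.sum_le_sum fun v _ => ?_
  have hfiber : Z ⁻¹' (U.filter (f · = v) : Finset β) = f ∘ Z ⁻¹' {v} := by
    ext ω
    simp [hU ω]
  refine (sum_splitEntropy_le _ (fun _ => measureReal_nonneg)
    fun _ => measureReal_nonneg).trans_eq ?_
  simp only [sum_measureReal_preimage_singleton_inter hZ, hfiber]

theorem condEntropy_le_binEntropy [IsProbabilityMeasure μ] {Z : Ω → β}
    (hZ : ∀ z, MeasurableSet (Z ⁻¹' {z})) {U : Finset β} (hU : ∀ ω, Z ω ∈ U) {D : Set Ω}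
    (hD : MeasurableSet D) : condEntropy μ Z U D ≤ binEntropy (μ.real D) := by
  have hfiber : Z ⁻¹' (U : Set β) = Set.univ := Set.eq_univ_of_forall hU
  refine (sum_splitEntropy_le _ (fun _ => measureReal_nonneg)
    fun _ => measureReal_nonneg).trans_eq ?_
  simp only [sum_measureReal_preimage_singleton_inter hZ, hfiber, Set.univ_inter,
    probReal_compl_eq_one_sub hD, splitEntropy_one_sub]

theorem binEntropy_sub_le_condEntropy [IsProbabilityMeasure μ] {Z : Ω → β}
    (hZ : ∀ z, MeasurableSet (Z ⁻¹' {z})) {U : Finset β} (hU : ∀ ω, Z ω ∈ U) {D : Set Ω}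
    (hD : MeasurableSet D) (hD0 : 0 < μ.real D) (hD1 : μ.real D < 1) :
    binEntropy (μ.real D) -
        (∑ z ∈ U, μ.real (Z ⁻¹' {z} ∩ D) ^ 2 / μ.real (Z ⁻¹' {z}) - μ.real D ^ 2) /
          (μ.real D * (1 - μ.real D)) ≤ condEntropy μ Z U D := by
  set q := μ.real D
  have hfiber : Z ⁻¹' (U : Set β) = Set.univ := Set.eq_univ_of_forall hU
  have hsum (E : Set Ω) : ∑ z ∈ U, μ.real (Z ⁻¹' {z} ∩ E) = μ.real E := by
    rw [sum_measureReal_preimage_singleton_inter hZ, hfiber, Set.univ_inter]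
  have hsplit (z : β) :
      μ.real (Z ⁻¹' {z} ∩ D) + μ.real (Z ⁻¹' {z} ∩ Dᶜ) = μ.real (Z ⁻¹' {z}) := by
    rw [← Set.sdiff_eq, measureReal_inter_add_sdiff hD]
  have hsum' : ∑ z ∈ U, μ.real (Z ⁻¹' {z}) = 1 := by
    simpa using hsum Set.univ
  refine le_trans (le_of_eq ?_) (Finset.sum_le_sum fun z _ =>
    le_splitEntropy measureReal_nonneg measureReal_nonneg hD0 hD1)
  simp only [hsplit, Finset.sum_sub_distrib, Finset.sum_add_distrib, ← Finset.sum_mul,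
    ← Finset.sum_div, ← Finset.mul_sum, hsum, hsum', probReal_compl_eq_one_sub hD]
  rw [binEntropy, log_inv, log_inv]
  ring

/-- The entropy of the part of the random set `S` inside `T`. -/
noncomputable def partialEntropy [DecidableEq C] (μ : Measure Ω) (S : Ω → Finset C)
    (T : Finset C) : ℝ :=
  ∑ s ∈ T.powerset, negMulLog (μ.real ((S · ∩ T) ⁻¹' {s}))

variable {S : Ω → Finset C}

theorem partialEntropy_insert [DecidableEq C] [IsFiniteMeasure μ] {T : Finset C} {c : C}
    (hc : c ∉ T) (hS : MeasurableSet {ω | c ∉ S ω}) :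
    partialEntropy μ S (insert c T) =
      partialEntropy μ S T + condEntropy μ (S · ∩ T) T.powerset {ω | c ∉ S ω} := by
  rw [partialEntropy, Finset.sum_powerset_insert hc, ← Finset.sum_add_distrib, partialEntropy,
    condEntropy, ← Finset.sum_add_distrib]
  refine Finset.sum_congr rfl fun s hs => ?_
  have hcs : c ∉ s := fun h => hc (Finset.mem_powerset.1 hs h)
  have hmiss : (S · ∩ insert c T) ⁻¹' {s} = (S · ∩ T) ⁻¹' {s} ∩ {ω | c ∉ S ω} := by
    ext ω
    by_cases h : c ∈ S ω
    · simp only [Set.mem_preimage, Set.mem_singleton_iff, Set.mem_inter_iff, Set.mem_ofPred_eq, h,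
        not_true, and_false, iff_false]
      rintro rfl
      exact hcs (by simp [h])
    · simp [Finset.inter_insert_of_notMem, h]
  have hhit : (S · ∩ insert c T) ⁻¹' {insert c s} = (S · ∩ T) ⁻¹' {s} ∩ {ω | c ∉ S ω}ᶜ := by
    ext ω
    by_cases h : c ∈ S ω
    · have hcST : c ∉ S ω ∩ T := fun h' => hc (Finset.mem_inter.1 h').2
      simp only [Set.mem_preimage, Set.mem_singleton_iff, Finset.inter_insert_of_mem h,
        Set.mem_inter_iff, Set.mem_compl_iff, Set.mem_ofPred_eq, h, not_true, not_false_eq_true,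
        and_true]
      exact ⟨fun h' => by simpa [hcST, hcs] using congrArg (Finset.erase · c) h',
        fun h' => congrArg (insert c) h'⟩
    · simp only [Set.mem_preimage, Set.mem_singleton_iff, Finset.inter_insert_of_notMem h,
        Set.mem_inter_iff, Set.mem_compl_iff, Set.mem_ofPred_eq, h, not_false_eq_true, not_true,
        and_false, iff_false]
      exact fun h' => h (Finset.mem_inter.1 (h' ▸ Finset.mem_insert_self c s)).1
  have hsplit := measureReal_inter_add_sdiff (μ := μ) (s := (S · ∩ T) ⁻¹' {s}) hS
  rw [Set.sdiff_eq] at hsplit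
  rw [hmiss, hhit, splitEntropy, hsplit]
  ring

theorem partialEntropy_le_sum_binEntropy [DecidableEq C] [IsProbabilityMeasure μ]
    (hS : ∀ p : Finset C → Prop, MeasurableSet {ω | p (S ω)}) (T : Finset C) :
    partialEntropy μ S T ≤ ∑ c ∈ T, binEntropy (μ.real {ω | c ∉ S ω}) := by
  induction T using Finset.induction_on with
  | empty => simp [partialEntropy]
  | insert c T hc ih =>
    rw [partialEntropy_insert hc (hS (c ∉ ·)), Finset.sum_insert hc, add_comm]
    exact add_le_add (condEntropy_le_binEntropy (fun s => hS (· ∩ T = s))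
      (fun ω => Finset.mem_powerset.2 Finset.inter_subset_right) (hS (c ∉ ·))) ih

variable [Countable C]

theorem tendsto_measureReal_inter_eq [DecidableEq C] [IsFiniteMeasure μ]
    (hS : ∀ p : Finset C → Prop, MeasurableSet {ω | p (S ω)}) (s : Finset C) :
    Tendsto (fun T => μ.real ((S · ∩ T) ⁻¹' {s})) atTop (𝓝 (μ.real (S ⁻¹' {s}))) := by
  have hinter : (⋂ T, {ω | S ω ∩ T = s ∩ T}) = S ⁻¹' {s} := by
    ext ω
    simp only [Set.mem_iInter, Set.mem_ofPred_eq, Set.mem_preimage, Set.mem_singleton_iff]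
    refine ⟨fun h => ?_, fun h T => h ▸ rfl⟩
    simpa [Finset.inter_eq_left.2 Finset.subset_union_left,
      Finset.inter_eq_left.2 Finset.subset_union_right] using h (S ω ∪ s)
  have hanti : Antitone fun T => {ω | S ω ∩ T = s ∩ T} := fun T T' hT ω hω => by
    have hω' : S ω ∩ T' = s ∩ T' := hω
    rw [Set.mem_ofPred_eq, ← Finset.inter_eq_right.2 hT, ← Finset.inter_assoc, hω',
      Finset.inter_assoc]
  have hlim := tendsto_measure_iInter_atTop (μ := μ)
    (fun T => (hS (· ∩ T = s ∩ T)).nullMeasurableSet) hanti ⟨∅, measure_ne_top _ _⟩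
  rw [hinter] at hlim
  refine ((ENNReal.tendsto_toReal (measure_ne_top _ _)).comp hlim).congr' ?_
  filter_upwards [eventually_ge_atTop s] with T hT
  simp only [Function.comp_apply, Finset.inter_eq_left.2 hT]
  rfl

theorem sum_negMulLog_le_tsum_binEntropy [IsProbabilityMeasure μ]
    (hS : ∀ p : Finset C → Prop, MeasurableSet {ω | p (S ω)})
    (hsum : Summable fun c => binEntropy (μ.real {ω | c ∉ S ω})) (F : Finset (Finset C)) :
    ∑ s ∈ F, negMulLog (μ.real (S ⁻¹' {s})) ≤ ∑' c, binEntropy (μ.real {ω | c ∉ S ω}) := by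
  classical
  have hlim : Tendsto (fun T => ∑ s ∈ F, negMulLog (μ.real ((S · ∩ T) ⁻¹' {s}))) atTop
      (𝓝 (∑ s ∈ F, negMulLog (μ.real (S ⁻¹' {s})))) :=
    tendsto_finsetSum _ fun s _ =>
      (continuous_negMulLog.tendsto _).comp (tendsto_measureReal_inter_eq hS s)
  refine le_of_tendsto hlim ?_
  filter_upwards [eventually_ge_atTop (F.biUnion id)] with T hT
  have hF : F ⊆ T.powerset := fun s hs => Finset.mem_powerset.2
    ((Finset.subset_biUnion_of_mem id hs).trans hT)
  calc ∑ s ∈ F, negMulLog (μ.real ((S · ∩ T) ⁻¹' {s}))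
      ≤ partialEntropy μ S T := Finset.sum_le_sum_of_subset_of_nonneg hF fun s _ _ =>
        negMulLog_nonneg measureReal_nonneg measureReal_le_one
    _ ≤ ∑ c ∈ T, binEntropy (μ.real {ω | c ∉ S ω}) := partialEntropy_le_sum_binEntropy hS T
    _ ≤ _ := hsum.sum_le_tsum _ fun c _ => binEntropy_nonneg measureReal_nonneg measureReal_le_one

theorem summable_negMulLog_of_summable_binEntropy [IsProbabilityMeasure μ]
    (hS : ∀ p : Finset C → Prop, MeasurableSet {ω | p (S ω)})
    (hsum : Summable fun c => binEntropy (μ.real {ω | c ∉ S ω})) :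
    Summable fun s => negMulLog (μ.real (S ⁻¹' {s})) :=
  summable_of_sum_le (fun _ => negMulLog_nonneg measureReal_nonneg measureReal_le_one)
    (sum_negMulLog_le_tsum_binEntropy hS hsum)

theorem tsum_negMulLog_le_tsum_binEntropy [IsProbabilityMeasure μ]
    (hS : ∀ p : Finset C → Prop, MeasurableSet {ω | p (S ω)})
    (hsum : Summable fun c => binEntropy (μ.real {ω | c ∉ S ω})) :
    ∑' s, negMulLog (μ.real (S ⁻¹' {s})) ≤ ∑' c, binEntropy (μ.real {ω | c ∉ S ω}) :=
  (summable_negMulLog_of_summable_binEntropy hS hsum).tsum_le_of_sum_le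
    (sum_negMulLog_le_tsum_binEntropy hS hsum)

theorem hasSum_measureReal_preimage_singleton_inter [Countable β] [IsFiniteMeasure μ] {Z : Ω → β}
    (hZ : ∀ z, MeasurableSet (Z ⁻¹' {z})) (E : Set Ω) :
    HasSum (fun z => μ.real (Z ⁻¹' {z} ∩ E)) (μ.real E) := by
  have htsum := tsum_measure_preimage_singleton (μ := μ.restrict E) (f := Z) Set.countable_univ
    fun z _ => hZ z
  rw [tsum_univ (f := fun z => μ.restrict E (Z ⁻¹' {z})), Set.preimage_univ] at htsum
  have hsum := ENNReal.hasSum_toReal (htsum.trans_ne (measure_ne_top _ _))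
  rw [← ENNReal.tsum_toReal_eq fun _ => measure_ne_top _ _, htsum] at hsum
  simpa only [← measureReal_def, measureReal_restrict_apply (hZ _),
    measureReal_restrict_apply MeasurableSet.univ, Set.univ_inter] using hsum

theorem partialEntropy_le_tsum_negMulLog [DecidableEq C] [IsProbabilityMeasure μ]
    (hS : ∀ p : Finset C → Prop, MeasurableSet {ω | p (S ω)})
    (hsum : Summable fun s => negMulLog (μ.real (S ⁻¹' {s}))) (T : Finset C) :
    partialEntropy μ S T ≤ ∑' s, negMulLog (μ.real (S ⁻¹' {s})) := by
  set P : Finset C → ℝ := fun u => μ.real ((S · ∩ T) ⁻¹' {u})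
  have hjoint : HasSum
      (fun s => ∑ u ∈ T.powerset, μ.real (S ⁻¹' {s} ∩ (S · ∩ T) ⁻¹' {u}) * -log (P u))
      (∑ u ∈ T.powerset, P u * -log (P u)) :=
    hasSum_sum fun u _ =>
      (hasSum_measureReal_preimage_singleton_inter (fun s => hS (· = s)) _).mul_right _
  have hpartial : partialEntropy μ S T = ∑ u ∈ T.powerset, P u * -log (P u) :=
    Finset.sum_congr rfl fun u _ => by rw [negMulLog, neg_mul_comm]
  rw [hpartial]
  refine hasSum_le (fun s => ?_) hjoint hsum.hasSum
  have hsub : S ⁻¹' {s} ⊆ (S · ∩ T) ⁻¹' {s ∩ T} := fun ω hω => congrArg (· ∩ T) hω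
  rw [Finset.sum_eq_single_of_mem (s ∩ T) (Finset.mem_powerset.2 Finset.inter_subset_right),
    Set.inter_eq_left.2 hsub, negMulLog, neg_mul_comm]
  · rcases (measureReal_nonneg (μ := μ) (s := S ⁻¹' {s})).eq_or_lt with h0 | h0
    · simp [← h0]
    · exact mul_le_mul_of_nonneg_left (neg_le_neg (log_le_log h0 (measureReal_mono hsub))) h0.le
  · intro u _ hu
    have hempty : S ⁻¹' {s} ∩ (S · ∩ T) ⁻¹' {u} = ∅ :=
      Set.eq_empty_of_forall_notMem fun ω hω => hu (hω.2.symm.trans (hsub hω.1))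
    rw [hempty, measureReal_empty, zero_mul]

end Entropy

section EntropyLowerBound

open Real

variable {Ω C : Type*} [MeasurableSpace Ω] {μ : Measure Ω} {ν : Measure (Option C)}
  {Y : ℕ → Ω → Option C}

theorem measureReal_some_image_finset [Countable C] [IsFiniteMeasure ν] (T : Finset C) :
    ν.real (some '' (T : Set C)) = ∑ c ∈ T, ν.real {some c} := by
  classical
  rw [← Finset.coe_image, ← sum_measureReal_singleton,
    Finset.sum_image (Option.some_injective C).injOn]

variable [DecidableEq C]

/-- The outcome as seen by an observer of the cells in `T`; hits of other cells count as misses. -/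
def observe (T : Finset C) (o : Option C) : Option T :=
  o.bind fun c => if hc : c ∈ T then some ⟨c, hc⟩ else none

theorem observe_eq_some_iff {T : Finset C} {o : Option C} {c : T} :
    observe T o = some c ↔ o = some (c : C) := by
  cases o with
  | none => simp [observe]
  | some d =>
    by_cases hd : d ∈ T
    · simp [observe, hd, Subtype.ext_iff]
    · have hdc : d ≠ c := fun h => hd (h ▸ c.2)
      simp [observe, hd, hdc]

theorem observe_eq_none_iff {T : Finset C} {o : Option C} :
    observe T o = none ↔ o ∉ some '' (T : Set C) := by
  cases o with
  | none => simp [observe]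
  | some d => simp [observe]

theorem sum_sq_measureReal_observe [Countable C] [IsProbabilityMeasure ν] {T : Finset C} {c : C}
    (hc : c ∉ T) :
    ∑ o, ν.real (observe T ⁻¹' {o} ∩ {some c}ᶜ) ^ 2 / ν.real (observe T ⁻¹' {o}) =
      (1 - ∑ d ∈ T, ν.real {some d} - ν.real {some c}) ^ 2 / (1 - ∑ d ∈ T, ν.real {some d}) +
        ∑ d ∈ T, ν.real {some d} := by
  have hnone : observe T ⁻¹' {none} = (some '' (T : Set C))ᶜ := by
    ext o
    exact observe_eq_none_iff
  have hnone_inter : observe T ⁻¹' {none} ∩ {some c}ᶜ =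
      (some '' ((insert c T : Finset C) : Set C))ᶜ := by
    rw [hnone, Finset.coe_insert, Set.image_insert_eq, Set.insert_eq, Set.compl_union,
      Set.inter_comm]
  have hsome (d : T) : observe T ⁻¹' {some d} = {some (d : C)} := by
    ext o
    exact observe_eq_some_iff
  have hsome_inter (d : T) : observe T ⁻¹' {some d} ∩ {some c}ᶜ = {some (d : C)} := by
    rw [hsome, Set.inter_eq_left, Set.singleton_subset_iff]
    exact fun h => hc (Option.some_injective C h ▸ d.2)
  rw [Fintype.sum_option, hnone_inter, hnone]
  simp only [hsome_inter]
  simp only [hsome, probReal_compl_eq_one_sub .of_discrete,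
    measureReal_some_image_finset, Finset.sum_insert hc]
  rw [Finset.sum_coe_sort T fun d => ν.real {some d} ^ 2 / ν.real {some d}]
  congr 1
  · ring
  · exact Finset.sum_congr rfl fun d _ => by rw [pow_two, mul_self_div_self]

theorem observe_fun_inter_eq (y : ℕ → Option C) (n : ℕ) (T : Finset C) :
    (Finset.univ.biUnion fun i : Fin n => ((observe T (y i)).map (↑)).toFinset) =
      occupied y n ∩ T := by
  ext c
  simp only [Finset.mem_biUnion, Finset.mem_univ, true_and, Option.mem_toFinset, Option.mem_def,
    Option.map_eq_some_iff, observe_eq_some_iff, Finset.mem_inter, mem_occupied]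
  constructor
  · rintro ⟨i, d, hd, rfl⟩
    exact ⟨⟨i, i.2, hd⟩, d.2⟩
  · rintro ⟨⟨i, hi, hic⟩, hc⟩
    exact ⟨⟨i, hi⟩, ⟨c, hc⟩, hic, rfl⟩

theorem second_moment_pow_sub_le {a A : ℝ} (ha : 0 ≤ a) (hA : 0 ≤ A) (hA1 : A < 1)
    (haA : A + a ≤ 1) (n : ℕ) :
    ((1 - A - a) ^ 2 / (1 - A) + A) ^ n - ((1 - a) ^ n) ^ 2 ≤ n * (a ^ 2 / (1 - A)) := by
  have h1A := sub_pos.2 hA1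
  set b := (1 - A - a) ^ 2 / (1 - A) + A
  have hb : b = (1 - a) ^ 2 + a ^ 2 * (A / (1 - A)) := by
    simp only [b]
    field_simp
    ring
  have hb0 : 0 ≤ b := by positivity
  have hb1 : b ≤ 1 := by
    have hle : (1 - A - a) ^ 2 / (1 - A) ≤ 1 - A := by
      rw [div_le_iff₀ h1A, ← pow_two]
      exact pow_le_pow_left₀ (by linarith) (by linarith) 2
    linarith
  have hmax : max |b| |(1 - a) ^ 2| ≤ 1 := by
    rw [abs_of_nonneg hb0, abs_of_nonneg (sq_nonneg _)]
    exact max_le hb1 (pow_le_one₀ (by linarith) (by linarith))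
  have hdiff : |b - (1 - a) ^ 2| ≤ a ^ 2 / (1 - A) := by
    rw [hb, add_sub_cancel_left, abs_of_nonneg (by positivity), ← mul_div_assoc]
    gcongr
    exact mul_le_of_le_one_right (sq_nonneg a) hA1.le
  calc b ^ n - ((1 - a) ^ n) ^ 2
      = b ^ n - ((1 - a) ^ 2) ^ n := by rw [← pow_mul, ← pow_mul, mul_comm]
    _ ≤ |b - (1 - a) ^ 2| * n * max |b| |(1 - a) ^ 2| ^ (n - 1) :=
        (le_abs_self _).trans (abs_pow_sub_pow_le _ _ n)
    _ ≤ a ^ 2 / (1 - A) * n * 1 := by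
        gcongr
        exact pow_le_one₀ (by positivity) hmax
    _ = n * (a ^ 2 / (1 - A)) := by ring

theorem one_sub_pow_le_inv {p : ℝ} (hp0 : 0 ≤ p) (hp1 : p ≤ 1) (n : ℕ) :
    (1 - p) ^ n ≤ (1 + n * p)⁻¹ := by
  have hbernoulli : 1 + n * p ≤ (1 + p) ^ n := one_add_mul_le_pow (by linarith) n
  rw [← one_div, le_div_iff₀ (by positivity)]
  calc (1 - p) ^ n * (1 + n * p) ≤ (1 - p) ^ n * (1 + p) ^ n := by gcongr
    _ = (1 - p ^ 2) ^ n := by rw [← mul_pow]; ring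
    _ ≤ 1 := pow_le_one₀ (by nlinarith) (by nlinarith)

theorem exp_neg_le_one_sub_pow {p : ℝ} (hp1 : p < 1) (n : ℕ) :
    exp (-(n * p / (1 - p))) ≤ (1 - p) ^ n := by
  have h1p := sub_pos.2 hp1
  have hlog := one_sub_inv_le_log_of_pos h1p
  rw [← exp_log (pow_pos h1p n), log_pow, exp_le_exp]
  calc -(n * p / (1 - p)) = n * (1 - (1 - p)⁻¹) := by
        field_simp
        ring
    _ ≤ n * log (1 - p) := by gcongr

theorem second_moment_error_le {p A B b : ℝ} (hp0 : 0 < p) (hpb : p ≤ b) (hA : 0 ≤ A)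
    (hB : A + p ≤ B) (hB1 : B < 1) {n : ℕ} (hn : 0 < n) :
    n * (p ^ 2 / (1 - A)) / ((1 - p) ^ n * (1 - (1 - p) ^ n)) ≤
      b * (1 + n * b) * exp (n * b / (1 - B)) / (1 - B) := by
  have : (0 : ℝ) < n := Nat.cast_pos.2 hn
  have hb0 := hp0.trans_le hpb
  have h1B := sub_pos.2 hB1
  have h1p : 0 < 1 - p := by linarith
  have hlow : exp (-(n * b / (1 - B))) ≤ (1 - p) ^ n := by
    refine le_trans ?_ (exp_neg_le_one_sub_pow (by linarith) n)
    gcongr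
    linarith
  have hhigh : n * p / (1 + n * p) ≤ 1 - (1 - p) ^ n := by
    refine le_trans (le_of_eq ?_) (sub_le_sub_left (one_sub_pow_le_inv hp0.le (by linarith) n) 1)
    field_simp
    ring
  calc n * (p ^ 2 / (1 - A)) / ((1 - p) ^ n * (1 - (1 - p) ^ n))
      ≤ n * (p ^ 2 / (1 - B)) / (exp (-(n * b / (1 - B))) * (n * p / (1 + n * p))) := by
        gcongr
        linarith
    _ = p * (1 + n * p) * exp (n * b / (1 - B)) / (1 - B) := by
        rw [exp_neg]
        field_simp
    _ ≤ _ := by gcongr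

namespace IsIIDSequence

variable [Countable C] [IsProbabilityMeasure μ]

theorem sum_sq_measureReal_observe_fun (h : IsIIDSequence μ ν Y) (n : ℕ) {T : Finset C}
    {c : C} (hc : c ∉ T) :
    ∑ z, μ.real ((fun ω (i : Fin n) => observe T (Y i ω)) ⁻¹' {z} ∩
        {ω | c ∉ occupied (Y · ω) n}) ^ 2 /
        μ.real ((fun ω (i : Fin n) => observe T (Y i ω)) ⁻¹' {z}) =
      ((1 - ∑ d ∈ T, ν.real {some d} - ν.real {some c}) ^ 2 / (1 - ∑ d ∈ T, ν.real {some d}) +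
        ∑ d ∈ T, ν.real {some d}) ^ n := by
  have := h.isProbabilityMeasure
  have hset (z : Fin n → Option T) : (fun ω (i : Fin n) => observe T (Y i ω)) ⁻¹' {z} =
      {ω | ∀ i : Fin n, Y i ω ∈ observe T ⁻¹' {z i}} := by
    ext ω
    simp [funext_iff]
  have hset_inter (z : Fin n → Option T) :
      (fun ω (i : Fin n) => observe T (Y i ω)) ⁻¹' {z} ∩ {ω | c ∉ occupied (Y · ω) n} =
        {ω | ∀ i : Fin n, Y i ω ∈ observe T ⁻¹' {z i} ∩ {some c}ᶜ} := by
    ext ω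
    simp [funext_iff, mem_occupied, forall_and, Fin.forall_iff]
  simp only [hset_inter]
  simp only [hset, h.measureReal_forall_mem fun _ => .of_discrete,
    ← Finset.prod_pow, ← Finset.prod_div_distrib]
  rw [← sum_sq_measureReal_observe hc, Fintype.sum_pow]

/-- The observed outcomes determine the occupied part of `T`, so conditioning on them instead
can only decrease the entropy that `c` adds. -/
theorem partialEntropy_add_le_partialEntropy_insert (h : IsIIDSequence μ ν Y) {n : ℕ}
    {T : Finset C} {c : C} (hc : c ∉ T) {b B : ℝ} (hb0 : 0 < ν.real {some c})
    (hb : ν.real {some c} ≤ b) (hB : ∑ d ∈ T, ν.real {some d} + ν.real {some c} ≤ B) (hB1 : B < 1)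
    (hn : 0 < n) :
    partialEntropy μ (fun ω => occupied (Y · ω) n) T +
        (binEntropy ((1 - ν.real {some c}) ^ n) -
          b * (1 + n * b) * exp (n * b / (1 - B)) / (1 - B)) ≤
      partialEntropy μ (fun ω => occupied (Y · ω) n) (insert c T) := by
  have := h.isProbabilityMeasure
  set p := ν.real {some c}
  set Z : Ω → Fin n → Option T := fun ω i => observe T (Y i ω)
  set f : (Fin n → Option T) → Finset C :=
    fun z => Finset.univ.biUnion fun i => ((z i).map (↑)).toFinset
  have hfZ : f ∘ Z = fun ω => occupied (Y · ω) n ∩ T :=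
    funext fun ω => observe_fun_inter_eq (Y · ω) n T
  have hZ (z : Fin n → Option T) : MeasurableSet (Z ⁻¹' {z}) :=
    h.measurable_of_dependsOn (f := fun y (i : Fin n) => observe T (y i))
      (fun y y' hyy' => funext fun i => congrArg (observe T) (hyy' i i.2))
      (measurableSet_singleton z)
  have hA : 0 ≤ ∑ d ∈ T, ν.real {some d} := Finset.sum_nonneg fun _ _ => measureReal_nonneg
  have hD := measureReal_notMem_occupied h n c
  have hq0 : 0 < (1 - p) ^ n := pow_pos (by linarith) n
  have hq1 : (1 - p) ^ n < 1 := pow_lt_one₀ (by linarith) (by linarith) hn.ne'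
  rw [partialEntropy_insert hc (measurableSet_setOf_occupied h n (c ∉ ·)), ← hfZ]
  refine add_le_add_right (le_trans ?_ (condEntropy_le_condEntropy_comp hZ
    (fun ω => Finset.mem_univ (Z ω)) ?_ _)) _
  · refine le_trans ?_ (binEntropy_sub_le_condEntropy hZ (fun ω => Finset.mem_univ (Z ω))
      (measurableSet_setOf_occupied h n (c ∉ ·)) (hD ▸ hq0) (hD ▸ hq1))
    rw [hD, h.sum_sq_measureReal_observe_fun n hc]
    refine sub_le_sub_left (le_trans ?_ (second_moment_error_le hb0 hb hA hB hB1 hn)) _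
    exact div_le_div_of_nonneg_right
      (second_moment_pow_sub_le hb0.le hA (by linarith) (by linarith) n)
      (mul_pos hq0 (sub_pos.2 hq1)).le
  · intro z _
    refine Finset.mem_powerset.2 fun d hd => ?_
    obtain ⟨i, -, hi⟩ := Finset.mem_biUnion.1 hd
    obtain ⟨e, -, rfl⟩ := Option.map_eq_some_iff.1 (Option.mem_toFinset.1 hi)
    exact e.2

theorem sum_binEntropy_sub_le_partialEntropy (h : IsIIDSequence μ ν Y) {n : ℕ} {T : Finset C}
    {b B : ℝ} (hb0 : ∀ c ∈ T, 0 < ν.real {some c}) (hb : ∀ c ∈ T, ν.real {some c} ≤ b)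
    (hB : ∑ c ∈ T, ν.real {some c} ≤ B) (hB1 : B < 1) (hn : 0 < n) :
    ∑ c ∈ T, binEntropy ((1 - ν.real {some c}) ^ n) -
        T.card * (b * (1 + n * b) * exp (n * b / (1 - B)) / (1 - B)) ≤
      partialEntropy μ (fun ω => occupied (Y · ω) n) T := by
  induction T using Finset.induction_on with
  | empty => simp [partialEntropy]
  | insert c T hc ih =>
    rw [Finset.sum_insert hc, add_comm] at hB
    have ih' := ih (fun d hd => hb0 d (Finset.mem_insert_of_mem hd))
      (fun d hd => hb d (Finset.mem_insert_of_mem hd))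
      (le_trans (le_add_of_nonneg_right measureReal_nonneg) hB)
    have hadd := h.partialEntropy_add_le_partialEntropy_insert hc
      (hb0 c (Finset.mem_insert_self c T)) (hb c (Finset.mem_insert_self c T)) hB hB1 hn
    rw [Finset.sum_insert hc, Finset.card_insert_of_notMem hc]
    push_cast
    linarith

end IsIIDSequence

end EntropyLowerBound

section RiemannSums

open Set

theorem iUnion_Ico_div {m : ℕ} (hm : 0 < m) :
    ⋃ k : ℕ, Ico ((k : ℝ) / m) (((k : ℝ) + 1) / m) = Ici 0 := by
  have hm' : (0 : ℝ) < m := Nat.cast_pos.2 hm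
  ext x
  simp only [mem_iUnion, mem_Ico, mem_Ici, div_le_iff₀' hm', lt_div_iff₀' hm']
  refine ⟨fun ⟨k, hk, _⟩ => nonneg_of_mul_nonneg_right (k.cast_nonneg.trans hk) hm', fun hx => ?_⟩
  exact ⟨⌊m * x⌋₊, Nat.floor_le (by positivity), Nat.lt_floor_add_one _⟩

theorem floor_mul_eq {m k : ℕ} (hm : 0 < m) {x : ℝ}
    (hx : x ∈ Ico ((k : ℝ) / m) (((k : ℝ) + 1) / m)) : ⌊(m : ℝ) * x⌋₊ = k := by
  have hm' : (0 : ℝ) < m := Nat.cast_pos.2 hm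
  rw [mem_Ico, div_le_iff₀' hm', lt_div_iff₀' hm'] at hx
  exact (Nat.floor_eq_iff (k.cast_nonneg.trans hx.1)).2 hx

theorem floor_mul_lt_mul_iff {m : ℕ} (hm : 0 < m) {x : ℝ} (hx : 0 ≤ x) (J : ℕ) :
    ⌊(m : ℝ) * x⌋₊ < J * m ↔ x < J := by
  have hm' : (0 : ℝ) < m := Nat.cast_pos.2 hm
  rw [Nat.floor_lt (by positivity), Nat.cast_mul, mul_comm (J : ℝ), mul_lt_mul_iff_right₀ hm']

theorem measurable_comp_floor (m : ℕ) (f : ℕ → ℝ) : Measurable fun x : ℝ => f ⌊m * x⌋₊ :=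
  (measurable_of_countable f).comp (Nat.measurable_floor.comp (measurable_const.mul measurable_id))

theorem hasSum_div_of_integrableOn {m : ℕ} (hm : 0 < m) {f : ℕ → ℝ}
    (hf : IntegrableOn (fun x : ℝ => f ⌊m * x⌋₊) (Ioi 0)) :
    HasSum (fun k => f k / m) (∫ x in Ioi (0 : ℝ), f ⌊m * x⌋₊) := by
  have hcell (k : ℕ) : ∫ x in Ico ((k : ℝ) / m) (((k : ℝ) + 1) / m), f ⌊m * x⌋₊ = f k / m := by
    rw [setIntegral_congr_fun measurableSet_Ico fun x hx => by rw [floor_mul_eq hm hx],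
      setIntegral_const, Real.volume_real_Ico_of_le (by gcongr; linarith), smul_eq_mul]
    ring
  rw [← integrableOn_Ici_iff_integrableOn_Ioi, ← iUnion_Ico_div hm] at hf
  rw [← integral_Ici_eq_integral_Ioi, ← iUnion_Ico_div hm]
  simp only [← hcell]
  refine hasSum_integral_iUnion (fun k => measurableSet_Ico) (fun k l hkl => ?_) hf
  exact Set.disjoint_left.2 fun x hk hl =>
    hkl ((floor_mul_eq hm hk).symm.trans (floor_mul_eq hm hl))

theorem hasSum_div_of_le {m : ℕ} (hm : 0 < m) {f : ℕ → ℝ} {G : ℝ → ℝ}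
    (hG : IntegrableOn G (Ioi 0)) (hle : ∀ x > 0, |f ⌊(m : ℝ) * x⌋₊| ≤ G x) :
    HasSum (fun k => f k / m) (∫ x in Ioi (0 : ℝ), f ⌊m * x⌋₊) :=
  hasSum_div_of_integrableOn hm (hG.mono' (measurable_comp_floor m f).aestronglyMeasurable
    (ae_restrict_of_forall_mem measurableSet_Ioi hle))

theorem tendsto_tsum_div {f : ℕ → ℕ → ℝ} {F G : ℝ → ℝ} (hG : IntegrableOn G (Ioi 0))
    (hle : ∀ m : ℕ, 0 < m → ∀ x > 0, |f m ⌊(m : ℝ) * x⌋₊| ≤ G x)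
    (hlim : ∀ x > 0, Tendsto (fun m : ℕ => f m ⌊(m : ℝ) * x⌋₊) atTop (𝓝 (F x))) :
    Tendsto (fun m : ℕ => ∑' k, f m k / m) atTop (𝓝 (∫ x in Ioi (0 : ℝ), F x)) := by
  have h := tendsto_integral_filter_of_dominated_convergence G
    (.of_forall fun m => (measurable_comp_floor m (f m)).aestronglyMeasurable)
    ((eventually_gt_atTop 0).mono fun m hm =>
      ae_restrict_of_forall_mem measurableSet_Ioi (hle m hm)) hG
    (ae_restrict_of_forall_mem measurableSet_Ioi hlim)
  exact h.congr' ((eventually_gt_atTop 0).mono fun m hm =>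
    (hasSum_div_of_le hm hG (hle m hm)).tsum_eq.symm)

theorem tendsto_sum_range_div {f : ℕ → ℕ → ℝ} {F : ℝ → ℝ} {B : ℝ} (J : ℕ)
    (hle : ∀ m k : ℕ, 0 < m → k < J * m → |f m k| ≤ B)
    (hlim : ∀ x : ℝ, 0 < x → x < J →
      Tendsto (fun m : ℕ => f m ⌊(m : ℝ) * x⌋₊) atTop (𝓝 (F x))) :
    Tendsto (fun m : ℕ => ∑ k ∈ Finset.range (J * m), f m k / m) atTop
      (𝓝 (∫ x in (0 : ℝ)..J, F x)) := by
  have hB : IntegrableOn ((Iio (J : ℝ)).indicator fun _ => B) (Ioi 0) := by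
    rw [IntegrableOn, integrable_indicator_iff measurableSet_Iio, IntegrableOn,
      Measure.restrict_restrict measurableSet_Iio, Iio_inter_Ioi]
    exact integrableOn_const (by simp)
  have h := tendsto_tsum_div (f := fun m k => if k < J * m then f m k else 0)
    (F := (Iio (J : ℝ)).indicator F) hB
    (fun m hm x hx => by
      by_cases hxJ : x < J
      · simpa only [floor_mul_lt_mul_iff hm hx.le, indicator, mem_Iio, hxJ, if_true] using
          hle m _ hm ((floor_mul_lt_mul_iff hm hx.le J).2 hxJ)
      · simp [floor_mul_lt_mul_iff hm hx.le, hxJ])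
    (fun x hx => by
      suffices Tendsto (fun m : ℕ => if x < J then f m ⌊(m : ℝ) * x⌋₊ else 0) atTop
          (𝓝 ((Iio (J : ℝ)).indicator F x)) from
        this.congr' ((eventually_gt_atTop 0).mono fun m hm => by
          simp only [floor_mul_lt_mul_iff hm hx.le])
      by_cases hxJ : x < J
      · simpa only [indicator, mem_Iio, hxJ, if_true] using hlim x hx hxJ
      · simpa only [indicator, mem_Iio, hxJ, if_false] using tendsto_const_nhds)
  rw [setIntegral_indicator measurableSet_Iio, Ioi_inter_Iio, ← integral_Ioc_eq_integral_Ioo,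
    ← intervalIntegral.integral_of_le J.cast_nonneg] at h
  refine h.congr fun m => ?_
  rw [tsum_eq_sum (s := Finset.range (J * m)) fun k hk => by
    rw [if_neg (mt Finset.mem_range.2 hk), zero_div]]
  exact Finset.sum_congr rfl fun k hk => by rw [if_pos (Finset.mem_range.1 hk)]

end RiemannSums

section CellAreas

open Real

/-- The density of the cell areas in the limit of many columns of base `exp β`: the `⌊x m⌋`-th
largest of the cells in `m` columns has area about `cellDensity β x / m`. -/
noncomputable def cellDensity (β x : ℝ) : ℝ := (1 - exp (-β)) * exp (-(β * x))

/-- The area of the `k`-th largest cell (counted from `0`) of the partition of base `exp β` with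
`m` columns. -/
noncomputable def cellArea (β : ℝ) (m k : ℕ) : ℝ := cellDensity β (k / m) / m

/-- The limiting probability that a dart changes the state after `t` darts per column of base
`exp β`. -/
noncomputable def limitFreeArea (β t : ℝ) : ℝ := (1 - exp (-(t * (1 - exp (-β))))) / (β * t)

variable {β : ℝ}

theorem one_sub_exp_neg_pos (hβ : 0 < β) : 0 < 1 - exp (-β) :=
  sub_pos.2 (exp_lt_one_iff.2 (neg_lt_zero.2 hβ))

theorem cellDensity_pos (hβ : 0 < β) (x : ℝ) : 0 < cellDensity β x :=
  mul_pos (one_sub_exp_neg_pos hβ) (exp_pos _)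

theorem cellDensity_le_one (hβ : 0 < β) {x : ℝ} (hx : 0 ≤ x) : cellDensity β x ≤ 1 :=
  mul_le_one₀ (sub_le_self _ (exp_pos _).le) (exp_pos _).le
    (exp_le_one_iff.2 (neg_nonpos.2 (mul_nonneg hβ.le hx)))

theorem cellDensity_antitone (hβ : 0 < β) : Antitone (cellDensity β) := fun x y hxy => by
  have := (one_sub_exp_neg_pos hβ).le
  rw [cellDensity, cellDensity]
  gcongr

@[fun_prop]
theorem continuous_cellDensity : Continuous (cellDensity β) := by
  unfold cellDensity
  fun_prop

theorem cellArea_pos (hβ : 0 < β) {m : ℕ} (hm : 0 < m) (k : ℕ) : 0 < cellArea β m k :=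
  div_pos (cellDensity_pos hβ _) (Nat.cast_pos.2 hm)

theorem cellArea_nonneg (hβ : 0 < β) (m k : ℕ) : 0 ≤ cellArea β m k :=
  div_nonneg (cellDensity_pos hβ _).le m.cast_nonneg

theorem mul_cellArea {m : ℕ} (hm : 0 < m) (k : ℕ) : m * cellArea β m k = cellDensity β (k / m) :=
  mul_div_cancel₀ _ (Nat.cast_pos.2 hm).ne'

theorem cellArea_le_one_div (hβ : 0 < β) (m k : ℕ) : cellArea β m k ≤ 1 / m :=
  div_le_div_of_nonneg_right (cellDensity_le_one hβ (by positivity)) m.cast_nonneg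

theorem cellArea_le_one (hβ : 0 < β) (m k : ℕ) : cellArea β m k ≤ 1 :=
  (cellArea_le_one_div hβ m k).trans (by simpa using m.cast_inv_le_one)

theorem sub_one_le_floor_mul_div {m : ℕ} (hm : 0 < m) (x : ℝ) :
    x - 1 ≤ (⌊(m : ℝ) * x⌋₊ : ℝ) / m := by
  have hm' : (1 : ℝ) ≤ m := Nat.one_le_cast.2 hm
  rw [le_div_iff₀' (by positivity)]
  linarith [(Nat.lt_floor_add_one ((m : ℝ) * x)).le]

theorem tendsto_floor_mul_div {x : ℝ} (hx : 0 ≤ x) :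
    Tendsto (fun m : ℕ => (⌊(m : ℝ) * x⌋₊ : ℝ) / m) atTop (𝓝 x) := by
  simpa only [Function.comp_def, mul_comm] using
    (tendsto_nat_floor_mul_div_atTop hx).comp (tendsto_natCast_atTop_atTop (R := ℝ))

theorem mul_cellArea_floor_le (hβ : 0 < β) {m : ℕ} (hm : 0 < m) (x : ℝ) :
    m * cellArea β m ⌊(m : ℝ) * x⌋₊ ≤ cellDensity β (x - 1) :=
  (mul_cellArea hm _).trans_le (cellDensity_antitone hβ (sub_one_le_floor_mul_div hm x))

theorem tendsto_mul_cellArea_floor {x : ℝ} (hx : 0 ≤ x) :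
    Tendsto (fun m : ℕ => m * cellArea β m ⌊(m : ℝ) * x⌋₊) atTop (𝓝 (cellDensity β x)) :=
  ((continuous_cellDensity.tendsto x).comp (tendsto_floor_mul_div hx)).congr'
    ((eventually_gt_atTop 0).mono fun _ hm => (mul_cellArea hm _).symm)

/-- Each block of `m` consecutive cells covers at most the fraction `1 - exp (-β)` of the area that
the previous blocks have left over. -/
theorem sum_range_mul_cellArea_le (hβ : 0 < β) {m : ℕ} (hm : 0 < m) (J : ℕ) :
    ∑ k ∈ Finset.range (J * m), cellArea β m k ≤ 1 - exp (-(β * J)) := by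
  have hm' : (m : ℝ) ≠ 0 := Nat.cast_ne_zero.2 hm.ne'
  induction J with
  | zero => simp
  | succ J ih =>
    have hblock : ∑ k ∈ Finset.range m, cellArea β m (J * m + k) ≤ cellDensity β J := by
      calc ∑ k ∈ Finset.range m, cellArea β m (J * m + k)
          ≤ ∑ _k ∈ Finset.range m, cellDensity β J / m := by
            refine Finset.sum_le_sum fun k _ => div_le_div_of_nonneg_right ?_ m.cast_nonneg
            refine cellDensity_antitone hβ ?_
            rw [Nat.cast_add, Nat.cast_mul, add_div, mul_div_cancel_right₀ _ hm']
            exact le_add_of_nonneg_right (by positivity)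
        _ = cellDensity β J := by
            rw [Finset.sum_const, Finset.card_range, nsmul_eq_mul, mul_div_cancel₀ _ hm']
    have hexp : exp (-(β * (J + 1 : ℕ))) = exp (-β) * exp (-(β * J)) := by
      rw [← exp_add, Nat.cast_succ]
      ring_nf
    rw [add_mul, one_mul, Finset.sum_range_add, hexp]
    rw [cellDensity] at hblock
    linarith

theorem tendsto_one_sub_pow {a : ℕ → ℝ} {n : ℕ → ℕ} {l t : ℝ} (ha1 : ∀ m, a m ≤ 1)
    (ha : Tendsto (fun m => m * a m) atTop (𝓝 l))
    (hn : Tendsto (fun m => (n m : ℝ) / m) atTop (𝓝 t)) :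
    Tendsto (fun m => (1 - a m) ^ n m) atTop (𝓝 (exp (-(t * l)))) := by
  have hpow : Tendsto (fun m => (1 - a m) ^ m) atTop (𝓝 (exp (-l))) := by
    simpa only [sub_eq_add_neg] using
      tendsto_one_add_pow_exp_of_tendsto (g := fun m => -a m) (by simpa only [mul_neg] using ha.neg)
  have h := hpow.rpow hn (Or.inl (exp_pos _).ne')
  rw [← exp_mul, neg_mul, mul_comm] at h
  refine h.congr' ((eventually_gt_atTop 0).mono fun m hm => ?_)
  rw [← rpow_natCast, ← rpow_mul (sub_nonneg.2 (ha1 m)),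
    mul_div_cancel₀ _ (Nat.cast_ne_zero.2 hm.ne'), rpow_natCast]

theorem tendsto_one_sub_cellArea_floor_pow (hβ : 0 < β) {n : ℕ → ℕ} {t x : ℝ}
    (hn : Tendsto (fun m => (n m : ℝ) / m) atTop (𝓝 t)) (hx : 0 ≤ x) :
    Tendsto (fun m => (1 - cellArea β m ⌊(m : ℝ) * x⌋₊) ^ n m) atTop
      (𝓝 (exp (-(t * cellDensity β x)))) :=
  tendsto_one_sub_pow (fun m => cellArea_le_one hβ m _) (tendsto_mul_cellArea_floor hx) hn

theorem integrableOn_cellDensity_sub (hβ : 0 < β) (b : ℝ) :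
    IntegrableOn (fun x => cellDensity β (x - b)) (Set.Ioi 0) := by
  refine Integrable.congr ((integrableOn_exp_mul_Ioi (neg_lt_zero.2 hβ) 0).const_mul
    ((1 - exp (-β)) * exp (β * b))) (ae_of_all _ fun x => ?_)
  simp only [cellDensity]
  rw [mul_assoc, ← exp_add]
  ring_nf

theorem integral_cellDensity_mul_exp (hβ : 0 < β) {t : ℝ} (ht : 0 < t) :
    ∫ x in Set.Ioi (0 : ℝ), cellDensity β x * exp (-(t * cellDensity β x)) = limitFreeArea β t := by
  have hd (x : ℝ) : HasDerivAt (fun x => exp (-(t * cellDensity β x)) / (β * t))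
      (cellDensity β x * exp (-(t * cellDensity β x))) x := by
    have h := ((hasDerivAt_id x).const_mul β).fun_neg.exp.const_mul (1 - exp (-β))
    refine ((h.const_mul t).fun_neg.exp.div_const (β * t)).congr_deriv ?_
    simp only [cellDensity, id]
    field_simp
  have hlim : Tendsto (fun x => exp (-(t * cellDensity β x)) / (β * t)) atTop
      (𝓝 (1 / (β * t))) := by
    have h : Tendsto (fun x => exp (-(β * x))) atTop (𝓝 0) :=
      tendsto_exp_neg_atTop_nhds_zero.comp (tendsto_id.const_mul_atTop hβ)
    simpa [cellDensity, Function.comp_def] using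
      ((continuous_exp.tendsto _).comp ((h.const_mul (1 - exp (-β))).const_mul t).neg).div_const
        (β * t)
  rw [integral_Ioi_of_hasDerivAt_of_nonneg' (fun x _ => hd x)
    (fun x _ => mul_nonneg (cellDensity_pos hβ x).le (exp_pos _).le) hlim, limitFreeArea, sub_div]
  simp [cellDensity]

theorem tendsto_tsum_cellArea_mul_pow (hβ : 0 < β) {n : ℕ → ℕ} {t : ℝ} (ht : 0 < t)
    (hn : Tendsto (fun m => (n m : ℝ) / m) atTop (𝓝 t)) :
    Tendsto (fun m => ∑' k, cellArea β m k * (1 - cellArea β m k) ^ n m) atTop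
      (𝓝 (limitFreeArea β t)) := by
  rw [← integral_cellDensity_mul_exp hβ ht]
  have h := tendsto_tsum_div (f := fun m k => m * cellArea β m k * (1 - cellArea β m k) ^ n m)
    (integrableOn_cellDensity_sub hβ 1)
    (fun m hm x _ => by
      have h0 := cellArea_nonneg hβ m ⌊(m : ℝ) * x⌋₊
      have h1 := sub_nonneg.2 (cellArea_le_one hβ m ⌊(m : ℝ) * x⌋₊)
      rw [abs_of_nonneg (by positivity)]
      exact (mul_le_of_le_one_right (by positivity) (pow_le_one₀ h1 (sub_le_self _ h0))).trans
        (mul_cellArea_floor_le hβ hm x))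
    (fun x hx => (tendsto_mul_cellArea_floor (le_of_lt hx)).mul
      (tendsto_one_sub_cellArea_floor_pow hβ hn (le_of_lt hx)))
  refine h.congr' ((eventually_gt_atTop 0).mono fun m hm => tsum_congr fun k => ?_)
  rw [mul_assoc, mul_div_cancel_left₀ _ (Nat.cast_ne_zero.2 hm.ne')]

theorem le_inv_limitFreeArea (hβ : 0 < β) {t : ℝ} (ht : 0 < t) :
    β * t ≤ 1 / limitFreeArea β t := by
  have hpos := one_sub_exp_neg_pos (mul_pos ht (one_sub_exp_neg_pos hβ))
  rw [limitFreeArea, one_div_div, le_div_iff₀ hpos]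
  exact mul_le_of_le_one_right (by positivity) (sub_le_self _ (exp_pos _).le)

theorem inv_limitFreeArea_le (hβ : 0 < β) {t : ℝ} (ht : 0 < t) :
    1 / limitFreeArea β t ≤ β * t + β / (1 - exp (-β)) := by
  have hL := one_sub_exp_neg_pos hβ
  have hpos := one_sub_exp_neg_pos (mul_pos ht hL)
  rw [limitFreeArea, one_div_div, div_le_iff₀ hpos]
  have hexp : (t * (1 - exp (-β)) + 1) * exp (-(t * (1 - exp (-β)))) ≤ 1 := by
    rw [exp_neg (t * _), ← div_eq_mul_inv, div_le_one (exp_pos _)]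
    exact add_one_le_exp _
  calc β * t ≤ β * t + β / (1 - exp (-β)) *
        (1 - (t * (1 - exp (-β)) + 1) * exp (-(t * (1 - exp (-β))))) :=
        le_add_of_nonneg_right (mul_nonneg (by positivity) (sub_nonneg.2 hexp))
    _ = (β * t + β / (1 - exp (-β))) * (1 - exp (-(t * (1 - exp (-β))))) := by
        field_simp
        ring

theorem limitFreeArea_pos (hβ : 0 < β) {t : ℝ} (ht : 0 < t) : 0 < limitFreeArea β t :=
  one_div_pos.1 ((mul_pos hβ ht).trans_le (le_inv_limitFreeArea hβ ht))

end CellAreas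

section EntropyLimit

open Real

variable {β : ℝ}

/-- The limiting sum, divided by the number of columns, of the entropies in nats of the states of
the individual cells after `t` darts per column of base `exp β`. -/
noncomputable def limitEntropy (β t : ℝ) : ℝ :=
  ∫ x in Set.Ioi (0 : ℝ), binEntropy (exp (-(t * cellDensity β x)))

theorem negMulLog_le_two_mul_sqrt {x : ℝ} (hx : 0 ≤ x) : negMulLog x ≤ 2 * √x := by
  have hlog : negMulLog x = 2 * √x * negMulLog √x := by
    rw [negMulLog, negMulLog, log_sqrt hx]
    nth_rewrite 1 [← mul_self_sqrt hx]
    ring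
  rw [hlog]
  refine mul_le_of_le_one_right (by positivity) ?_
  linarith [negMulLog_le_one_sub_self (sqrt_nonneg x), sqrt_nonneg x]

theorem binEntropy_le_three_mul_sqrt {p : ℝ} (hp : 0 ≤ p) (hp1 : p ≤ 1) :
    binEntropy p ≤ 3 * √(1 - p) := by
  have hsqrt : 1 - p ≤ √(1 - p) := le_sqrt_of_sq_le (by nlinarith)
  rw [binEntropy_eq_negMulLog_add_negMulLog_one_sub]
  linarith [negMulLog_le_one_sub_self hp, negMulLog_le_two_mul_sqrt (sub_nonneg.2 hp1)]

theorem one_sub_one_sub_pow_le {a : ℝ} (ha : a ≤ 1) (n : ℕ) : 1 - (1 - a) ^ n ≤ n * a := by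
  linarith [one_add_mul_sub_le_pow (by linarith : -1 ≤ 1 - a) n]

theorem binEntropy_one_sub_cellArea_pow_nonneg (hβ : 0 < β) (m k n : ℕ) :
    0 ≤ binEntropy ((1 - cellArea β m k) ^ n) :=
  have h := sub_nonneg.2 (cellArea_le_one hβ m k)
  binEntropy_nonneg (pow_nonneg h n) (pow_le_one₀ h (sub_le_self _ (cellArea_nonneg hβ m k)))

theorem binEntropy_one_sub_cellArea_floor_pow_le (hβ : 0 < β) (l : ℕ) {m n : ℕ} (hm : 0 < m)
    (hn : n ≤ l * m) (x : ℝ) :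
    binEntropy ((1 - cellArea β m ⌊(m : ℝ) * x⌋₊) ^ n) ≤ 3 * √(l * cellDensity β (x - 1)) := by
  set a := cellArea β m ⌊(m : ℝ) * x⌋₊
  have h0 : 0 ≤ a := cellArea_nonneg hβ m _
  have h1 : 0 ≤ 1 - a := sub_nonneg.2 (cellArea_le_one hβ m _)
  have hpow : 1 - (1 - a) ^ n ≤ l * cellDensity β (x - 1) :=
    calc 1 - (1 - a) ^ n ≤ n * a := one_sub_one_sub_pow_le (sub_nonneg.1 h1) n
      _ ≤ (l * m : ℕ) * a := by gcongr
      _ = l * (m * a) := by rw [Nat.cast_mul, mul_assoc]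
      _ ≤ l * cellDensity β (x - 1) := by gcongr; exact mul_cellArea_floor_le hβ hm x
  calc binEntropy ((1 - a) ^ n)
      ≤ 3 * √(1 - (1 - a) ^ n) :=
        binEntropy_le_three_mul_sqrt (pow_nonneg h1 n) (pow_le_one₀ h1 (sub_le_self _ h0))
    _ ≤ 3 * √(l * cellDensity β (x - 1)) := by gcongr

theorem abs_binEntropy_one_sub_cellArea_floor_pow_le (hβ : 0 < β) (l : ℕ) {m n : ℕ} (hm : 0 < m)
    (hn : n ≤ l * m) (x : ℝ) :
    |binEntropy ((1 - cellArea β m ⌊(m : ℝ) * x⌋₊) ^ n)| ≤ 3 * √(l * cellDensity β (x - 1)) :=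
  (abs_of_nonneg (binEntropy_one_sub_cellArea_pow_nonneg hβ m _ n)).trans_le
    (binEntropy_one_sub_cellArea_floor_pow_le hβ l hm hn x)

theorem integrableOn_sqrt_mul_cellDensity_sub (hβ : 0 < β) (t b : ℝ) :
    IntegrableOn (fun x => √(t * cellDensity β (x - b))) (Set.Ioi 0) := by
  refine Integrable.congr ((integrableOn_exp_mul_Ioi (by linarith : -(β / 2) < 0) 0).const_mul
    √(t * ((1 - exp (-β)) * exp (β * b)))) (ae_of_all _ fun x => ?_)
  have hexp : exp (-(β / 2) * x) = √(exp (-(β * x))) := by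
    rw [← exp_half]
    ring_nf
  simp only [cellDensity]
  rw [hexp, ← sqrt_mul' _ (exp_pos _).le, mul_assoc, mul_assoc, ← exp_add]
  ring_nf

theorem summable_binEntropy_one_sub_cellArea_pow (hβ : 0 < β) {m : ℕ} (hm : 0 < m) (n : ℕ) :
    Summable fun k => binEntropy ((1 - cellArea β m k) ^ n) := by
  have h := (hasSum_div_of_le hm (f := fun k => binEntropy ((1 - cellArea β m k) ^ n))
    ((integrableOn_sqrt_mul_cellDensity_sub hβ n 1).const_mul 3) fun x _ =>
      abs_binEntropy_one_sub_cellArea_floor_pow_le hβ n hm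
        (Nat.le_mul_of_pos_right n hm) x).summable
  simpa only [div_mul_cancel₀ _ (Nat.cast_ne_zero (R := ℝ).2 hm.ne')] using h.mul_right (m : ℝ)

theorem tendsto_mul_div (l : ℕ) :
    Tendsto (fun m : ℕ => ((l * m : ℕ) : ℝ) / m) atTop (𝓝 l) :=
  tendsto_const_nhds.congr' ((eventually_gt_atTop 0).mono fun m hm => by
    simp only [Nat.cast_mul, mul_div_cancel_right₀ _ (Nat.cast_ne_zero (R := ℝ).2 hm.ne')])

theorem tendsto_binEntropy_one_sub_cellArea_floor_pow (hβ : 0 < β) (l : ℕ) {x : ℝ} (hx : 0 ≤ x) :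
    Tendsto (fun m : ℕ => binEntropy ((1 - cellArea β m ⌊(m : ℝ) * x⌋₊) ^ (l * m))) atTop
      (𝓝 (binEntropy (exp (-(l * cellDensity β x))))) :=
  (binEntropy_continuous.tendsto _).comp
    (tendsto_one_sub_cellArea_floor_pow hβ (tendsto_mul_div l) hx)

theorem tendsto_tsum_binEntropy_div (hβ : 0 < β) (l : ℕ) :
    Tendsto (fun m : ℕ => (∑' k, binEntropy ((1 - cellArea β m k) ^ (l * m))) / m) atTop
      (𝓝 (limitEntropy β l)) := by
  simp only [← tsum_div_const]
  exact tendsto_tsum_div (f := fun m k => binEntropy ((1 - cellArea β m k) ^ (l * m)))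
    ((integrableOn_sqrt_mul_cellDensity_sub hβ l 1).const_mul 3)
    (fun m hm x _ => abs_binEntropy_one_sub_cellArea_floor_pow_le hβ l hm le_rfl x)
    (fun x hx => tendsto_binEntropy_one_sub_cellArea_floor_pow hβ l (le_of_lt hx))

theorem tendsto_sum_range_binEntropy_div (hβ : 0 < β) (l J : ℕ) :
    Tendsto (fun m : ℕ => (∑ k ∈ Finset.range (J * m),
      binEntropy ((1 - cellArea β m k) ^ (l * m))) / m) atTop
      (𝓝 (∫ x in (0 : ℝ)..J, binEntropy (exp (-(l * cellDensity β x))))) := by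
  simp only [Finset.sum_div]
  exact tendsto_sum_range_div J (B := log 2)
    (f := fun m k => binEntropy ((1 - cellArea β m k) ^ (l * m)))
    (fun m k _ _ => (abs_of_nonneg (binEntropy_one_sub_cellArea_pow_nonneg hβ m k _)).trans_le
      binEntropy_le_log_two)
    (fun x hx _ => tendsto_binEntropy_one_sub_cellArea_floor_pow hβ l hx.le)

theorem integrableOn_binEntropy_exp_neg_mul_cellDensity (hβ : 0 < β) {t : ℝ} (ht : 0 ≤ t) :
    IntegrableOn (fun x => binEntropy (exp (-(t * cellDensity β x)))) (Set.Ioi 0) := by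
  have hint := integrableOn_sqrt_mul_cellDensity_sub hβ t 0
  simp only [sub_zero] at hint
  refine Integrable.mono' (hint.const_mul 3) (Continuous.aestronglyMeasurable (by fun_prop))
    (ae_of_all _ fun x => ?_)
  have h1 : exp (-(t * cellDensity β x)) ≤ 1 :=
    exp_le_one_iff.2 (neg_nonpos.2 (mul_nonneg ht (cellDensity_pos hβ x).le))
  rw [norm_of_nonneg (binEntropy_nonneg (exp_pos _).le h1)]
  refine (binEntropy_le_three_mul_sqrt (exp_pos _).le h1).trans ?_
  gcongr
  linarith [one_sub_le_exp_neg (t * cellDensity β x)]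

theorem image_mul_cellDensity_Ioi (hβ : 0 < β) {t : ℝ} (ht : 0 < t) :
    (fun x => t * cellDensity β x) '' Set.Ioi 0 = Set.Ioo 0 (t * (1 - exp (-β))) := by
  have hT := mul_pos ht (one_sub_exp_neg_pos hβ)
  ext v
  simp only [Set.mem_image, Set.mem_Ioi, Set.mem_Ioo, cellDensity, ← mul_assoc]
  constructor
  · rintro ⟨x, hx, rfl⟩
    exact ⟨by positivity, mul_lt_of_lt_one_right hT (exp_lt_one_iff.2 (by nlinarith))⟩
  · rintro ⟨hv, hvT⟩
    refine ⟨log (t * (1 - exp (-β)) / v) / β,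
      div_pos (log_pos ((one_lt_div hv).2 hvT)) hβ, ?_⟩
    have hβ' := one_sub_exp_neg_pos hβ
    rw [mul_div_cancel₀ _ hβ.ne', exp_neg (log _), exp_log (by positivity)]
    field_simp

theorem limitEntropy_eq (hβ : 0 < β) {t : ℝ} (ht : 0 < t) :
    limitEntropy β t
      = β⁻¹ * ∫ v in (0 : ℝ)..t * (1 - exp (-β)), v⁻¹ * binEntropy (exp (-v)) := by
  have hd (x : ℝ) : HasDerivAt (fun x => t * cellDensity β x) (-(β * (t * cellDensity β x))) x := by
    have h := ((hasDerivAt_id x).const_mul β).fun_neg.exp.const_mul (1 - exp (-β))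
    refine (h.const_mul t).congr_deriv ?_
    simp only [cellDensity, id]
    ring
  have hanti : AntitoneOn (fun x => t * cellDensity β x) (Set.Ioi 0) :=
    ((cellDensity_antitone hβ).const_mul ht.le).antitoneOn _
  have hsubst := integral_image_eq_integral_deriv_smul_of_antitoneOn measurableSet_Ioi
    (fun x _ => (hd x).hasDerivWithinAt) hanti fun v => v⁻¹ * binEntropy (exp (-v))
  rw [image_mul_cellDensity_Ioi hβ ht, ← integral_Ioc_eq_integral_Ioo,
    ← intervalIntegral.integral_of_le (mul_pos ht (one_sub_exp_neg_pos hβ)).le] at hsubst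
  rw [hsubst, ← integral_const_mul, limitEntropy]
  refine integral_congr_ae (ae_of_all _ fun x => ?_)
  have := (cellDensity_pos hβ x).ne'
  simp only [smul_eq_mul]
  field_simp

theorem hasSum_inv_mul_binEntropy_exp_neg {v : ℝ} (hv : 0 < v) :
    HasSum (fun k : ℕ => ((k : ℝ) + 1)⁻¹ *
      (v⁻¹ • (exp (-((k + 1) * v)) - exp (-((k + 1 + 1) * v)))))
      (v⁻¹ * binEntropy (exp (-v)) - exp (-v)) := by
  have hpow (k : ℕ) : exp (-((k + 1) * v)) = exp (-v) ^ (k + 1) := by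
    rw [← exp_nat_mul, Nat.cast_succ, mul_neg]
  have hpow' (k : ℕ) : exp (-((k + 1 + 1) * v)) = exp (-v) ^ (k + 1) * exp (-v) := by
    rw [← hpow, ← exp_add]
    ring_nf
  have hsum := (hasSum_pow_div_log_of_abs_lt_one (x := exp (-v))
    (by rw [abs_of_pos (exp_pos _)]; exact exp_lt_one_iff.2 (neg_lt_zero.2 hv))).mul_left
      (v⁻¹ * (1 - exp (-v)))
  have hval : v⁻¹ * binEntropy (exp (-v)) - exp (-v)
      = v⁻¹ * (1 - exp (-v)) * -log (1 - exp (-v)) := by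
    rw [binEntropy_eq_negMulLog_add_negMulLog_one_sub, negMulLog, negMulLog, log_exp]
    field_simp
    ring
  rw [hval]
  refine hsum.congr_fun fun k => ?_
  rw [hpow, hpow', smul_eq_mul]
  ring

theorem integrableOn_inv_mul_exp_sub_exp {a b : ℝ} (ha : 0 < a) (hab : a ≤ b) :
    IntegrableOn (fun v => v⁻¹ • (exp (-(a * v)) - exp (-(b * v)))) (Set.Ioi 0) := by
  have hbound : IntegrableOn (fun v => (b - a) * exp (-a * v)) (Set.Ioi 0) :=
    (integrableOn_exp_mul_Ioi (neg_lt_zero.2 ha) 0).const_mul _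
  refine hbound.mono' (Measurable.aestronglyMeasurable (by fun_prop))
    (ae_restrict_of_forall_mem measurableSet_Ioi fun v (hv : 0 < v) => ?_)
  have hle : exp (-(b * v)) ≤ exp (-(a * v)) := by gcongr
  have hexp : exp (-(b * v)) = exp (-(a * v)) * exp (-((b - a) * v)) := by
    rw [← exp_add]
    ring_nf
  have hsub : exp (-(a * v)) - exp (-(b * v)) ≤ exp (-(a * v)) * ((b - a) * v) := by
    rw [hexp]
    nlinarith [exp_pos (-(a * v)), one_sub_le_exp_neg ((b - a) * v)]
  rw [smul_eq_mul, norm_of_nonneg (mul_nonneg (inv_nonneg.2 hv.le) (sub_nonneg.2 hle)),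
    inv_mul_le_iff₀ hv, neg_mul]
  linarith

theorem integral_inv_mul_exp_sub_exp {a b : ℝ} (ha : 0 < a) (hab : a ≤ b) :
    ∫ v in Set.Ioi 0, v⁻¹ • (exp (-(a * v)) - exp (-(b * v))) = log (b / a) := by
  have hL : Tendsto (fun v => exp (-v)) (𝓝[>] 0) (𝓝 1) := by
    simpa using (Continuous.tendsto (by fun_prop : Continuous fun v => exp (-v)) 0).mono_left
      nhdsWithin_le_nhds
  have h := Frullani.integral_Ioi_eq (f := fun v => exp (-v))
    ((by fun_prop : Continuous fun v => exp (-v)).locallyIntegrable.locallyIntegrableOn _) ha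
    (ha.trans_le hab) hL tendsto_exp_neg_atTop_nhds_zero (integrableOn_inv_mul_exp_sub_exp ha hab)
  simpa using h

theorem log_add_two_div_add_one (k : ℕ) :
    log ((k + 1 + 1) / (k + 1)) = log (1 + 1 / ((k : ℝ) + 1)) := by
  congr 1
  field_simp

theorem log_one_add_inv_pos (k : ℕ) : 0 < log (1 + 1 / ((k : ℝ) + 1)) :=
  log_pos (lt_add_of_pos_right _ (by positivity))

theorem inv_mul_log_le (k : ℕ) :
    ((k : ℝ) + 1)⁻¹ * log (1 + 1 / ((k : ℝ) + 1)) ≤ 1 / ((k : ℝ) + 1) ^ 2 := by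
  have h : log (1 + 1 / ((k : ℝ) + 1)) ≤ 1 / ((k : ℝ) + 1) := by
    linarith [log_le_sub_one_of_pos (by positivity : 0 < 1 + 1 / ((k : ℝ) + 1))]
  calc ((k : ℝ) + 1)⁻¹ * log (1 + 1 / ((k : ℝ) + 1)) ≤ ((k : ℝ) + 1)⁻¹ * (1 / ((k : ℝ) + 1)) := by
        gcongr
    _ = 1 / ((k : ℝ) + 1) ^ 2 := by field_simp

theorem summable_inv_mul_log :
    Summable fun k : ℕ => ((k : ℝ) + 1)⁻¹ * log (1 + 1 / ((k : ℝ) + 1)) := by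
  refine Summable.of_nonneg_of_le (fun k => ?_) inv_mul_log_le ?_
  · exact mul_nonneg (by positivity) (log_one_add_inv_pos k).le
  · exact_mod_cast (summable_nat_add_iff 1).2 (summable_one_div_nat_pow.2 (le_refl 2))

theorem H0_mul_log_two :
    H0 * log 2 = 1 + ∑' k : ℕ, ((k : ℝ) + 1)⁻¹ * log (1 + 1 / ((k : ℝ) + 1)) := by
  rw [H0, add_mul, inv_mul_cancel₀ (log_pos one_lt_two).ne', ← tsum_mul_right]
  congr 1
  refine tsum_congr fun k => ?_
  rw [logb, mul_assoc, div_mul_cancel₀ _ (log_pos one_lt_two).ne']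

/-- Expanding `log (1 - exp (-v))` turns the integrand into `exp (-v)` plus a series of Frullani
integrands. -/
theorem hasSum_integral_binEntropy_exp_neg :
    HasSum (fun k : ℕ => ((k : ℝ) + 1)⁻¹ * log (1 + 1 / ((k : ℝ) + 1)))
      (∫ v in Set.Ioi (0 : ℝ), (v⁻¹ * binEntropy (exp (-v)) - exp (-v))) := by
  set F : ℕ → ℝ → ℝ := fun k v =>
    ((k : ℝ) + 1)⁻¹ * (v⁻¹ • (exp (-((k + 1) * v)) - exp (-((k + 1 + 1) * v))))
  have hFint (k : ℕ) : IntegrableOn (F k) (Set.Ioi 0) :=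
    (integrableOn_inv_mul_exp_sub_exp (by positivity) (by linarith)).const_mul _
  have hF_eq (k : ℕ) : ∫ v in Set.Ioi 0, F k v = ((k : ℝ) + 1)⁻¹ * log (1 + 1 / ((k : ℝ) + 1)) := by
    rw [integral_const_mul, integral_inv_mul_exp_sub_exp (by positivity) (by linarith),
      log_add_two_div_add_one]
  have hF_norm (k : ℕ) : ∫ v in Set.Ioi 0, ‖F k v‖ = ∫ v in Set.Ioi 0, F k v := by
    refine setIntegral_congr_fun measurableSet_Ioi fun v (hv : 0 < v) => norm_of_nonneg ?_
    refine mul_nonneg (by positivity) (smul_nonneg (inv_nonneg.2 hv.le) (sub_nonneg.2 ?_))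
    gcongr
    linarith
  have h := hasSum_integral_of_summable_integral_norm hFint (by
    simpa only [hF_norm, hF_eq] using summable_inv_mul_log)
  simp only [hF_eq] at h
  rwa [setIntegral_congr_fun measurableSet_Ioi fun v hv =>
    (hasSum_inv_mul_binEntropy_exp_neg hv).tsum_eq] at h

theorem integrableOn_inv_mul_binEntropy_exp_neg :
    IntegrableOn (fun v => v⁻¹ * binEntropy (exp (-v))) (Set.Ioi 0) := by
  have hsub : IntegrableOn (fun v => v⁻¹ * binEntropy (exp (-v)) - exp (-v)) (Set.Ioi 0) := by
    refine Integrable.of_integral_ne_zero ?_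
    rw [← hasSum_integral_binEntropy_exp_neg.tsum_eq]
    exact (summable_inv_mul_log.tsum_pos
      (fun k => mul_nonneg (by positivity) (log_one_add_inv_pos k).le) 0
      (mul_pos (by positivity) (log_one_add_inv_pos 0))).ne'
  exact (hsub.add (integrableOn_exp_neg_Ioi 0)).congr (ae_of_all _ fun v => sub_add_cancel _ _)

theorem integral_inv_mul_binEntropy_exp_neg :
    ∫ v in Set.Ioi (0 : ℝ), v⁻¹ * binEntropy (exp (-v)) = H0 * log 2 := by
  rw [H0_mul_log_two, hasSum_integral_binEntropy_exp_neg.tsum_eq,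
    integral_sub integrableOn_inv_mul_binEntropy_exp_neg (integrableOn_exp_neg_Ioi 0),
    integral_exp_neg_Ioi_zero, add_sub_cancel]

theorem tendsto_limitEntropy (hβ : 0 < β) :
    Tendsto (limitEntropy β) atTop (𝓝 (β⁻¹ * (H0 * log 2))) := by
  rw [← integral_inv_mul_binEntropy_exp_neg]
  have h := intervalIntegral_tendsto_integral_Ioi 0 integrableOn_inv_mul_binEntropy_exp_neg
    (tendsto_id.atTop_mul_const (one_sub_exp_neg_pos hβ))
  exact (h.const_mul β⁻¹).congr' ((eventually_gt_atTop 0).mono fun t ht =>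
    (limitEntropy_eq hβ ht).symm)

end EntropyLimit

section NumericalValue

open Real

theorem log_one_add_one_div_le {s : ℝ} (hs : 0 < s) :
    log (1 + 1 / s) ≤ (2 * s + 1) / (2 * s * (s + 1)) := by
  have hy : 1 ≤ 1 + 1 / s := le_add_of_nonneg_right (by positivity)
  refine (self_le_sinh_iff.2 (log_nonneg hy)).trans_eq ?_
  rw [sinh_log (by positivity)]
  field_simp
  ring

theorem le_log_one_add_one_div {s : ℝ} (hs : 0 < s) : 2 / (2 * s + 1) ≤ log (1 + 1 / s) := by
  refine Eq.trans_le ?_ (le_log_one_add_of_nonneg (one_div_nonneg.2 hs.le))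
  field_simp
  ring

theorem sum_range_one_div_sub (b : ℝ) (n : ℕ) :
    ∑ k ∈ Finset.range n, (1 / ((k : ℝ) + b) - 1 / ((k : ℝ) + 1 + b)) =
      1 / b - 1 / ((n : ℝ) + b) := by
  simpa only [Nat.cast_add, Nat.cast_one, Nat.cast_zero, zero_add] using
    Finset.sum_range_sub' (fun k : ℕ => 1 / ((k : ℝ) + b)) n

theorem tsum_inv_mul_log_tail_le :
    ∑' k : ℕ, (((k + 4 : ℕ) : ℝ) + 1)⁻¹ * log (1 + 1 / (((k + 4 : ℕ) : ℝ) + 1)) ≤ 1 / 4.74 := by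
  have hterm (k : ℕ) : (((k + 4 : ℕ) : ℝ) + 1)⁻¹ * log (1 + 1 / (((k + 4 : ℕ) : ℝ) + 1)) ≤
      1 / ((k : ℝ) + 4.74) - 1 / ((k : ℝ) + 1 + 4.74) := by
    have hk : (0 : ℝ) ≤ k := k.cast_nonneg
    refine (mul_le_mul_of_nonneg_left (log_one_add_one_div_le (by positivity))
      (by positivity)).trans ?_
    push_cast
    rw [div_sub_div _ _ (by positivity) (by positivity), inv_mul_eq_div, div_div,
      div_le_div_iff₀ (by positivity) (by positivity)]
    nlinarith [pow_nonneg hk 2, pow_nonneg hk 3, pow_nonneg hk 4]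
  refine tsum_le_of_sum_range_le
    (fun k => mul_nonneg (by positivity) (log_one_add_inv_pos (k + 4)).le) fun n => ?_
  refine (Finset.sum_le_sum fun k _ => hterm k).trans ?_
  rw [sum_range_one_div_sub]
  exact sub_le_self _ (by positivity)

theorem le_tsum_inv_mul_log_tail :
    1 / 4.77 ≤ ∑' k : ℕ, (((k + 4 : ℕ) : ℝ) + 1)⁻¹ * log (1 + 1 / (((k + 4 : ℕ) : ℝ) + 1)) := by
  have hterm (k : ℕ) : 1 / ((k : ℝ) + 4.77) - 1 / ((k : ℝ) + 1 + 4.77) ≤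
      (((k + 4 : ℕ) : ℝ) + 1)⁻¹ * log (1 + 1 / (((k + 4 : ℕ) : ℝ) + 1)) := by
    refine le_trans ?_ (mul_le_mul_of_nonneg_left (le_log_one_add_one_div (by positivity))
      (by positivity))
    push_cast
    rw [div_sub_div _ _ (by positivity) (by positivity), inv_mul_eq_div, div_div,
      div_le_div_iff₀ (by positivity) (by positivity)]
    nlinarith
  have hlim : Tendsto (fun n : ℕ => 1 / (4.77 : ℝ) - 1 / ((n : ℝ) + 4.77)) atTop
      (𝓝 (1 / 4.77)) := by
    simpa only [one_div, sub_zero, Function.comp_def] using tendsto_const_nhds.sub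
      ((tendsto_inv_atTop_zero (𝕜 := ℝ)).comp
      (tendsto_atTop_add_const_right _ _ tendsto_natCast_atTop_atTop))
  refine le_of_tendsto_of_tendsto' hlim
    ((summable_nat_add_iff 4).2 summable_inv_mul_log).hasSum.tendsto_sum_nat fun n => ?_
  rw [← sum_range_one_div_sub]
  exact Finset.sum_le_sum fun k _ => hterm k

theorem abs_H0_div_two_sub_lt : |H0 / 2 - 1.63| < 0.005 := by
  have hsplit := summable_inv_mul_log.sum_add_tsum_nat_add 4
  have htail_le := tsum_inv_mul_log_tail_le
  have hle_tail := le_tsum_inv_mul_log_tail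
  have hle_two := le_log_one_add_one_div (s := 2) two_pos
  have htwo_le := log_one_add_one_div_le (s := 2) two_pos
  have hle_three := le_log_one_add_one_div (s := 3) three_pos
  have hthree_le := log_one_add_one_div_le (s := 3) three_pos
  have hle_four := le_log_one_add_one_div (s := 4) four_pos
  have hfour_le := log_one_add_one_div_le (s := 4) four_pos
  have hlog_gt := log_two_gt_d9
  have hlog_lt := log_two_lt_d9
  have hlog : 0 < log 2 := log_pos one_lt_two
  simp only [Finset.sum_range_succ, Finset.sum_range_zero] at hsplit
  norm_num at hsplit htail_le hle_tail hle_two htwo_le hle_three hthree_le hle_four hfour_le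
  rw [eq_div_of_mul_eq hlog.ne' H0_mul_log_two, div_div, abs_lt, lt_sub_iff_add_lt,
    sub_lt_iff_lt_add, lt_div_iff₀ (by positivity), div_lt_iff₀ (by positivity)]
  simp only [one_div]
  rw [← hsplit]
  constructor <;> linarith

end NumericalValue

section Geometry

open Real

/-- The rank of a cell of the smoothed base-`q` partition with `m` columns in the order of
decreasing area. -/
def cellRank (m : ℕ) [NeZero m] : Fin m × ℕ ≃ ℕ :=
  (Equiv.prodComm _ _).trans (Nat.divModEquiv m).symm

theorem cellRank_apply {m : ℕ} [NeZero m] (c : Fin m × ℕ) : cellRank m c = c.2 * m + c.1 := rfl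

theorem offset_add {m : ℕ} [NeZero m] (c : Fin m × ℕ) :
    offset c.1 + (c.2 : ℝ) = (cellRank m c : ℝ) / m := by
  have hm : (m : ℝ) ≠ 0 := NeZero.ne (m : ℝ)
  rw [cellRank_apply, offset]
  push_cast
  field_simp
  ring

theorem measurableSet_cellRegion (q : ℝ) {m : ℕ} (c : Fin m × ℕ) :
    MeasurableSet (cellRegion q c) := measurableSet_Ico.prod measurableSet_Ico

variable {q : ℝ} {m : ℕ}

theorem cellRegion_subset [NeZero m] (hq : 1 ≤ q) (c : Fin m × ℕ) :
    cellRegion q c ⊆ Set.Icc (0 : ℝ) 1 ×ˢ Set.Icc (0 : ℝ) 1 := by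
  have hm : (0 : ℝ) < m := Nat.cast_pos.2 (NeZero.pos m)
  have hright : ((c.1 : ℝ) + 1) / m ≤ 1 := by
    rw [div_le_one hm]
    exact_mod_cast c.1.2
  have htop : q ^ (-(offset c.1 + (c.2 : ℝ))) ≤ 1 := by
    refine rpow_le_one_of_one_le_of_nonpos hq (neg_nonpos.2 ?_)
    rw [offset_add]
    positivity
  rintro ⟨x, y⟩ ⟨hx, hy⟩
  exact ⟨⟨le_trans (by positivity) hx.1, hx.2.le.trans hright⟩,
    ⟨le_trans (by positivity) hy.1, hy.2.le.trans htop⟩⟩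

theorem dartLaw_real_cellRegion [NeZero m] (hq : 1 ≤ q) (c : Fin m × ℕ) :
    dartLaw.real (cellRegion q c) = cellArea (log q) m (cellRank m c) := by
  have hq0 : 0 < q := one_pos.trans_le hq
  have hheight : q ^ (-(offset c.1 + (c.2 + 1 : ℝ))) ≤ q ^ (-(offset c.1 + (c.2 : ℝ))) :=
    rpow_le_rpow_of_exponent_le hq (by linarith)
  have hwidth : (c.1 : ℝ) / m ≤ ((c.1 : ℝ) + 1) / m := by gcongr; linarith
  rw [measureReal_def, dartLaw, Measure.restrict_apply (measurableSet_cellRegion _ _),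
    Set.inter_eq_left.2 (cellRegion_subset hq c), cellRegion, Measure.volume_eq_prod,
    Measure.prod_prod, volume_Ico, volume_Ico, ENNReal.toReal_mul,
    ENNReal.toReal_ofReal (sub_nonneg.2 hwidth), ENNReal.toReal_ofReal (sub_nonneg.2 hheight),
    rpow_def_of_pos hq0, rpow_def_of_pos hq0, ← add_assoc, offset_add, cellArea, cellDensity,
    neg_add, mul_add, exp_add, ← sub_div]
  ring_nf

theorem eq_of_mem_cellRegion (hq : 1 < q) {c d : Fin m × ℕ} {y : ℝ × ℝ}
    (hc : y ∈ cellRegion q c) (hd : y ∈ cellRegion q d) : c = d := by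
  have hm : 0 < m := c.1.pos
  obtain ⟨hc₁, hc₂⟩ := hc
  obtain ⟨hd₁, hd₂⟩ := hd
  have hcol : c.1 = d.1 := Fin.ext ((floor_mul_eq hm hc₁).symm.trans (floor_mul_eq hm hd₁))
  rw [hcol] at hc₂
  have hdc := (rpow_lt_rpow_left_iff hq).1 (hc₂.1.trans_lt hd₂.2)
  have hcd := (rpow_lt_rpow_left_iff hq).1 (hd₂.1.trans_lt hc₂.2)
  have hdc' : d.2 < c.2 + 1 := by exact_mod_cast (by linarith : (d.2 : ℝ) < (c.2 : ℝ) + 1)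
  have hcd' : c.2 < d.2 + 1 := by exact_mod_cast (by linarith : (c.2 : ℝ) < (d.2 : ℝ) + 1)
  exact Prod.ext hcol (by lia)

theorem cellOf_eq_some_iff (hq : 1 < q) {c : Fin m × ℕ} {y : ℝ × ℝ} :
    cellOf q m y = some c ↔ y ∈ cellRegion q c := by
  unfold cellOf
  split_ifs with h
  · rw [Option.some_inj]
    exact ⟨fun hc => hc ▸ h.choose_spec, eq_of_mem_cellRegion hq h.choose_spec⟩
  · exact ⟨nofun, fun hc => (h ⟨c, hc⟩).elim⟩

theorem preimage_cellOf_some (hq : 1 < q) (c : Fin m × ℕ) :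
    cellOf q m ⁻¹' {some c} = cellRegion q c := by
  ext y
  exact cellOf_eq_some_iff hq

theorem measurable_cellOf (hq : 1 < q) (m : ℕ) : Measurable (cellOf q m) := by
  have hsome (c) : MeasurableSet (cellOf q m ⁻¹' {some c}) :=
    preimage_cellOf_some hq c ▸ measurableSet_cellRegion q c
  refine measurable_to_countable' fun o => ?_
  cases o with
  | some c => exact hsome c
  | none =>
    have hnone : cellOf q m ⁻¹' {none} = (⋃ c, cellOf q m ⁻¹' {some c})ᶜ := by
      ext y
      simp only [Set.mem_preimage, Set.mem_singleton_iff, Set.mem_compl_iff, Set.mem_iUnion,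
        not_exists, Option.eq_none_iff_forall_ne_some]
    rw [hnone]
    exact (MeasurableSet.iUnion hsome).compl

/-- The law of the cell of the smoothed base-`q` partition with `m` columns that is hit by a
dart. -/
noncomputable def cellLaw (q : ℝ) (m : ℕ) : Measure (Option (Fin m × ℕ)) :=
  dartLaw.map (cellOf q m)

theorem cellLaw_real_some [NeZero m] (hq : 1 < q) (c : Fin m × ℕ) :
    (cellLaw q m).real {some c} = cellArea (log q) m (cellRank m c) := by
  rw [cellLaw, map_measureReal_apply (measurable_cellOf hq m) MeasurableSet.of_discrete,
    preimage_cellOf_some hq, dartLaw_real_cellRegion hq.le]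

theorem sketch_eq_occupied (q : ℝ) (m : ℕ) (x : ℕ → ℝ × ℝ) (n : ℕ) :
    sketch q m x n = occupied (fun k => cellOf q m (x k)) n := by
  induction n with
  | zero => rfl
  | succ n ih => rw [sketch, occupied_succ, update, ih]

theorem changeProb_eq_freeArea (hq : 1 < q) (m : ℕ) (x : ℕ → ℝ × ℝ) (k : ℕ) :
    changeProb q m x k =
      freeArea (cellLaw q m) (occupied (fun i => cellOf q m (x i)) (k - 1)) := by
  rw [changeProb, freeArea, cellLaw, map_measureReal_apply (measurable_cellOf hq m)
    MeasurableSet.of_discrete, sketch_eq_occupied]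
  congr 1
  ext y
  exact union_toFinset_ne_iff

theorem martingaleEstimator_eq_estimate (hq : 1 < q) (m : ℕ) (x : ℕ → ℝ × ℝ) (n : ℕ) :
    martingaleEstimator q m x n = estimate (cellLaw q m) (fun i => cellOf q m (x i)) n := by
  induction n with
  | zero => rfl
  | succ n ih =>
    rw [martingaleEstimator, Finset.sum_Icc_succ_top n.succ_pos, ← martingaleEstimator, ih,
      estimate, estimate, Finset.sum_range_succ, changeProb_eq_freeArea hq]
    simp only [sketch_eq_occupied, Nat.add_sub_cancel]

theorem tsum_comp_cellLaw_real [NeZero m] (hq : 1 < q) (g : ℝ → ℝ) :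
    ∑' c, g ((cellLaw q m).real {some c}) = ∑' k, g (cellArea (log q) m k) := by
  simp_rw [cellLaw_real_some hq]
  exact (cellRank m).tsum_eq fun k => g (cellArea (log q) m k)

/-- The `N` largest cells of the smoothed base-`q` partition with `m` columns. -/
def largestCells (m N : ℕ) [NeZero m] : Finset (Fin m × ℕ) :=
  (Finset.range N).map (cellRank m).symm.toEmbedding

theorem card_largestCells [NeZero m] (N : ℕ) : (largestCells m N).card = N := by
  rw [largestCells, Finset.card_map, Finset.card_range]

theorem mem_largestCells [NeZero m] {N : ℕ} {c : Fin m × ℕ} :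
    c ∈ largestCells m N ↔ cellRank m c < N := by
  rw [largestCells, Finset.mem_map_equiv, Equiv.symm_symm, Finset.mem_range]

theorem sum_largestCells [NeZero m] (hq : 1 < q) (N : ℕ) (g : ℝ → ℝ) :
    ∑ c ∈ largestCells m N, g ((cellLaw q m).real {some c}) =
      ∑ k ∈ Finset.range N, g (cellArea (log q) m k) := by
  simp only [largestCells, Finset.sum_map, cellLaw_real_some hq, Equiv.coe_toEmbedding,
    Equiv.apply_symm_apply]

theorem cellArea_antitone {β : ℝ} (hβ : 0 < β) (m : ℕ) : Antitone (cellArea β m) :=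
  fun _ _ h => div_le_div_of_nonneg_right (cellDensity_antitone hβ (by gcongr)) m.cast_nonneg

theorem mul_cellArea_le_freeArea [NeZero m] [IsProbabilityMeasure (cellLaw q m)] (hq : 1 < q)
    {r N : ℕ} {s : Finset (Fin m × ℕ)} (h : s.card + r ≤ N) :
    r * cellArea (log q) m N ≤ freeArea (cellLaw q m) s := by
  refine mul_le_freeArea (T := largestCells m N) (fun c hc => ?_)
    (cellArea_nonneg (log_pos hq) m N) ?_
  · rw [cellLaw_real_some hq]
    exact cellArea_antitone (log_pos hq) m (mem_largestCells.1 hc).le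
  · rwa [card_largestCells]

end Geometry

section FreeAreaLimit

open Real
open scoped NNReal

variable {Ω : Type*} [MeasurableSpace Ω] {μ : Measure Ω} [IsProbabilityMeasure μ] {q : ℝ}
  {Y : (m : ℕ) → ℕ → Ω → Option (Fin m × ℕ)}

theorem tendsto_integral_freeArea (hq : 1 < q) (hY : ∀ m, IsIIDSequence μ (cellLaw q m) (Y m))
    {n : ℕ → ℕ} {t : ℝ} (ht : 0 < t) (hn : Tendsto (fun m => (n m : ℝ) / m) atTop (𝓝 t)) :
    Tendsto (fun m => ∫ ω, freeArea (cellLaw q m) (occupied (Y m · ω) (n m)) ∂μ) atTop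
      (𝓝 (limitFreeArea (log q) t)) := by
  refine (tendsto_tsum_cellArea_mul_pow (log_pos hq) ht hn).congr'
    ((eventually_gt_atTop 0).mono fun m hm => ?_)
  have : NeZero m := ⟨hm.ne'⟩
  have := (hY m).isProbabilityMeasure
  dsimp only
  rw [integral_freeArea_occupied (hY m), tsum_comp_cellLaw_real hq fun a => a * (1 - a) ^ n m]

theorem hasSubgaussianMGF_freeArea (hq : 1 < q) {m : ℕ} (hm : 0 < m)
    (hY : IsIIDSequence μ (cellLaw q m) (Y m)) (n : ℕ) :
    HasSubgaussianMGF (fun ω => freeArea (cellLaw q m) (occupied (Y m · ω) n) -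
      ∫ ω, freeArea (cellLaw q m) (occupied (Y m · ω) n) ∂μ) (n * (1 / m / 2) ^ 2) μ := by
  have : NeZero m := ⟨hm.ne'⟩
  have := hY.isProbabilityMeasure
  refine hY.hasSubgaussianMGF_sub_integral (f := fun y => freeArea (cellLaw q m) (occupied y n))
    (fun y y' hyy' => congrArg _ (dependsOn_occupied n hyy')) fun i y o => ?_
  push_cast
  refine abs_freeArea_occupied_update_sub_le (fun c => ?_) (by positivity) n i y o
  rw [cellLaw_real_some hq]
  exact cellArea_le_one_div (log_pos hq) m _

-- One dart changes the free area by at most `1 / m`, so `O(m)` darts make it deviate from its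
-- mean by `O(1 / √m)`, with Gaussian tails.
theorem ae_tendsto_freeArea (hq : 1 < q) (hY : ∀ m, IsIIDSequence μ (cellLaw q m) (Y m))
    {n : ℕ → ℕ} {l : ℕ} (hnl : ∀ m, n m ≤ l * m) {t : ℝ} (ht : 0 < t)
    (hn : Tendsto (fun m => (n m : ℝ) / m) atTop (𝓝 t)) :
    ∀ᵐ ω ∂μ, Tendsto (fun m => freeArea (cellLaw q m) (occupied (Y m · ω) (n m))) atTop
      (𝓝 (limitFreeArea (log q) t)) := by
  have hvar (m : ℕ) : (n m : ℝ≥0) * (1 / m / 2) ^ 2 ≤ l / m :=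
    calc (n m : ℝ≥0) * (1 / m / 2) ^ 2 ≤ ((l * m : ℕ) : ℝ≥0) * (1 / m / 2) ^ 2 := by
          gcongr
          exact hnl m
      _ = (l : ℝ≥0) / m * (1 / 2) ^ 2 := by
          push_cast
          field_simp
      _ ≤ l / m := mul_le_of_le_one_right' (pow_le_one' (half_le_self zero_le_one) 2)
  filter_upwards [ae_tendsto_zero_of_hasSubgaussianMGF ((eventually_gt_atTop 0).mono fun m hm =>
    hasSubgaussianMGF_freeArea hq hm (hY m) (n m)) (.of_forall hvar)] with ω hω
  simpa only [sub_add_cancel, zero_add] using hω.add (tendsto_integral_freeArea hq hY ht hn)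

theorem tendsto_mul_sub_one_div {l : ℕ} (hl : 1 ≤ l) :
    Tendsto (fun m : ℕ => ((l * m - 1 : ℕ) : ℝ) / m) atTop (𝓝 l) := by
  have h := (tendsto_mul_div l).sub (tendsto_one_div_atTop_nhds_zero_nat (𝕜 := ℝ))
  rw [sub_zero] at h
  refine h.congr' ((eventually_gt_atTop 0).mono fun m hm => ?_)
  simp only [Nat.cast_sub (show 1 ≤ l * m from Nat.mul_pos hl hm), Nat.cast_one, sub_div]

theorem tendsto_mul_limitFreeArea {β : ℝ} (hβ : 0 < β) :
    Tendsto (fun t => t * limitFreeArea β t) atTop (𝓝 (1 / β)) := by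
  have h : Tendsto (fun t : ℝ => (1 - exp (-(t * (1 - exp (-β))))) / β) atTop
      (𝓝 ((1 - 0) / β)) :=
    ((tendsto_exp_neg_atTop_nhds_zero.comp
      (tendsto_id.atTop_mul_const (one_sub_exp_neg_pos hβ))).const_sub 1).div_const β
  rw [sub_zero] at h
  refine h.congr' ((eventually_gt_atTop 0).mono fun t ht => ?_)
  simp only [limitFreeArea]
  field_simp

end FreeAreaLimit

section VarianceLimit

open Real

theorem tendsto_integral_div_sq {f : ℝ → ℝ} {a b c : ℝ}
    (hf : ∀ t, 0 < t → IntervalIntegrable f volume 0 t) (hb : ∀ x, 0 < x → a * x + b ≤ f x)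
    (hc : ∀ x, 0 < x → f x ≤ a * x + c) :
    Tendsto (fun t => (∫ x in (0 : ℝ)..t, f x) / t ^ 2) atTop (𝓝 (a / 2)) := by
  have hint (d t : ℝ) : IntervalIntegrable (fun x => a * x + d) volume 0 t :=
    Continuous.intervalIntegrable (by fun_prop) _ _
  have hlinear (d t : ℝ) (ht : 0 < t) :
      (∫ x in (0 : ℝ)..t, (a * x + d)) / t ^ 2 = a / 2 + d * t⁻¹ := by
    rw [intervalIntegral.integral_add (Continuous.intervalIntegrable (by fun_prop) _ _)
      intervalIntegrable_const, intervalIntegral.integral_const_mul, integral_id,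
      intervalIntegral.integral_const, smul_eq_mul]
    field_simp
    ring
  have hlim (d : ℝ) : Tendsto (fun t : ℝ => a / 2 + d * t⁻¹) atTop (𝓝 (a / 2)) := by
    simpa only [mul_zero, add_zero] using (tendsto_inv_atTop_zero.const_mul d).const_add (a / 2)
  refine tendsto_of_tendsto_of_tendsto_of_le_of_le' (hlim b) (hlim c) ?_ ?_
  · filter_upwards [eventually_gt_atTop 0] with t ht
    rw [← hlinear b t ht]
    exact div_le_div_of_nonneg_right (intervalIntegral.integral_mono_on_of_le_Ioo ht.le
      (hint b t) (hf t ht) fun x hx => hb x hx.1) (sq_nonneg t)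
  · filter_upwards [eventually_gt_atTop 0] with t ht
    rw [← hlinear c t ht]
    exact div_le_div_of_nonneg_right (intervalIntegral.integral_mono_on_of_le_Ioo ht.le
      (hf t ht) (hint c t) fun x hx => hc x hx.1) (sq_nonneg t)

/-- The limit of `m * Var(E_{m, t m}) / (t m)²` as the number `m` of columns tends to infinity,
for the smoothed partition with base `exp β`. -/
noncomputable def limitVariance (β t : ℝ) : ℝ :=
  (∫ x in (0 : ℝ)..t, (1 / limitFreeArea β x - 1)) / t ^ 2

theorem intervalIntegrable_one_div_limitFreeArea_sub_one {β : ℝ} (hβ : 0 < β) {t : ℝ}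
    (ht : 0 < t) : IntervalIntegrable (fun x => 1 / limitFreeArea β x - 1) volume 0 t := by
  rw [intervalIntegrable_iff_integrableOn_Ioc_of_le ht.le]
  have hmeas : Measurable fun x => 1 / limitFreeArea β x := by
    unfold limitFreeArea
    fun_prop
  refine Integrable.sub ?_ (integrableOn_const (by simp))
  refine Integrable.mono' (g := fun x => β * x + β / (1 - exp (-β)))
    (Continuous.integrableOn_Ioc (by fun_prop)) hmeas.aestronglyMeasurable
    (ae_restrict_of_forall_mem measurableSet_Ioc fun x hx => ?_)
  rw [norm_of_nonneg (one_div_nonneg.2 (limitFreeArea_pos hβ hx.1).le)]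
  exact inv_limitFreeArea_le hβ hx.1

theorem tendsto_limitVariance {β : ℝ} (hβ : 0 < β) :
    Tendsto (limitVariance β) atTop (𝓝 (β / 2)) :=
  tendsto_integral_div_sq
    (fun _ ht => intervalIntegrable_one_div_limitFreeArea_sub_one hβ ht)
    (fun _ hx => sub_le_sub_right (le_inv_limitFreeArea hβ hx) 1)
    fun _ hx => (sub_le_sub_right (inv_limitFreeArea_le hβ hx) 1).trans_eq (add_sub_assoc _ _ _)

variable {Ω : Type*} [MeasurableSpace Ω] {μ : Measure Ω} [IsProbabilityMeasure μ] {q : ℝ}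
  {Y : (m : ℕ) → ℕ → Ω → Option (Fin m × ℕ)}

theorem mul_cellDensity_le_freeArea (hq : 1 < q) {m : ℕ} [IsProbabilityMeasure (cellLaw q m)]
    {l : ℕ} {s : Finset (Fin m × ℕ)} (hs : s.card < l * m) :
    l * cellDensity (log q) (2 * l) ≤ freeArea (cellLaw q m) s := by
  have hm : 0 < m := Nat.pos_of_mul_pos_left (s.card.zero_le.trans_lt hs)
  have : NeZero m := ⟨hm.ne'⟩
  have hm' : (m : ℝ) ≠ 0 := NeZero.ne (m : ℝ)
  refine Eq.trans_le ?_ (mul_cellArea_le_freeArea (r := l * m) (N := 2 * (l * m)) hq (by lia))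
  rw [Nat.cast_mul, mul_assoc, mul_cellArea hm]
  push_cast
  field_simp

theorem tendsto_integral_one_div_freeArea (hq : 1 < q)
    (hY : ∀ m, IsIIDSequence μ (cellLaw q m) (Y m)) {l : ℕ} {x : ℝ} (hx : 0 < x) (hxl : x < l) :
    Tendsto (fun m : ℕ => ∫ ω, 1 / freeArea (cellLaw q m)
      (occupied (Y m · ω) ⌊(m : ℝ) * x⌋₊) ∂μ) atTop (𝓝 (1 / limitFreeArea (log q) x)) := by
  have hδ : 0 < l * cellDensity (log q) (2 * l) :=
    mul_pos (hx.trans hxl) (cellDensity_pos (log_pos hq) _)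
  have hprob m := (hY m).isProbabilityMeasure
  have hF (m : ℕ) (s : Finset (Fin m × ℕ)) (hs : s.card < l * m) :=
    mul_cellDensity_le_freeArea hq hs
  have hlt (m : ℕ) (hm : 0 < m) : ⌊(m : ℝ) * x⌋₊ < l * m := (floor_mul_lt_mul_iff hm hx.le l).2 hxl
  have hle (m : ℕ) : ⌊(m : ℝ) * x⌋₊ ≤ l * m := by
    refine Nat.floor_le_of_le ?_
    push_cast
    rw [mul_comm]
    gcongr
  have h := tendsto_integral_filter_of_dominated_convergence (l := atTop) (μ := μ)
    (F := fun (m : ℕ) ω => 1 / freeArea (cellLaw q m) (occupied (Y m · ω) ⌊(m : ℝ) * x⌋₊))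
    (f := fun _ => 1 / limitFreeArea (log q) x)
    (fun _ => 1 / (l * cellDensity (log q) (2 * l)))
    ((eventually_gt_atTop 0).mono fun m hm =>
      ((hY m).integrable_one_div_freeArea hδ (hF m) (hlt m hm)).aestronglyMeasurable)
    ((eventually_gt_atTop 0).mono fun m hm => ae_of_all _ fun ω => by
      have hle := hF m _ ((card_occupied_le (Y m · ω) _).trans_lt (hlt m hm))
      rw [norm_of_nonneg (one_div_nonneg.2 (hδ.le.trans hle))]
      exact one_div_le_one_div_of_le hδ hle)
    (integrable_const _)
    ((ae_tendsto_freeArea hq hY hle hx (tendsto_floor_mul_div hx.le)).mono fun ω hω =>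
      tendsto_const_nhds.div hω (limitFreeArea_pos (log_pos hq) hx).ne')
  simpa only [integral_const, probReal_univ, one_smul] using h

theorem abs_integral_one_div_freeArea_sub_one_le {C : Type*} [DecidableEq C] [Countable C]
    {ν : Measure (Option C)} {Z : ℕ → Ω → Option C} (h : IsIIDSequence μ ν Z) {δ : ℝ} (hδ : 0 < δ)
    {n k : ℕ} (hF : ∀ s : Finset C, s.card < n → δ ≤ freeArea ν s) (hk : k < n) :
    |∫ ω, 1 / freeArea ν (occupied (Z · ω) k) ∂μ - 1| ≤ 1 / δ + 1 := by
  have hnonneg : 0 ≤ ∫ ω, 1 / freeArea ν (occupied (Z · ω) k) ∂μ :=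
    integral_nonneg fun ω => one_div_nonneg.2 measureReal_nonneg
  have hle : ∫ ω, 1 / freeArea ν (occupied (Z · ω) k) ∂μ ≤ 1 / δ := by
    refine (integral_mono (h.integrable_one_div_freeArea hδ hF hk)
      (integrable_const (1 / δ)) fun ω => one_div_le_one_div_of_le hδ
        (hF _ ((card_occupied_le _ _).trans_lt hk))).trans_eq ?_
    rw [integral_const, probReal_univ, one_smul]
  rw [abs_le]
  constructor <;> linarith [one_div_pos.2 hδ]

theorem tendsto_variance_estimate (hq : 1 < q) (hY : ∀ m, IsIIDSequence μ (cellLaw q m) (Y m))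
    {l : ℕ} (hl : 1 ≤ l) :
    Tendsto (fun m : ℕ => (m : ℝ) * (Var[fun ω => estimate (cellLaw q m) (Y m · ω) (l * m); μ] /
      ((l * m : ℕ) : ℝ) ^ 2)) atTop (𝓝 (limitVariance (log q) l)) := by
  have hl' : (0 : ℝ) < l := Nat.cast_pos.2 hl
  have hδ : 0 < l * cellDensity (log q) (2 * l) := mul_pos hl' (cellDensity_pos (log_pos hq) _)
  have hprob m := (hY m).isProbabilityMeasure
  have hF (m : ℕ) (s : Finset (Fin m × ℕ)) (hs : s.card < l * m) :=
    mul_cellDensity_le_freeArea hq hs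
  have h := tendsto_sum_range_div l
    (fun m k _ hk => abs_integral_one_div_freeArea_sub_one_le (hY m) hδ (hF m) hk)
    fun x hx hxl => (tendsto_integral_one_div_freeArea hq hY hx hxl).sub_const 1
  refine (h.div_const ((l : ℝ) ^ 2)).congr fun m => ?_
  rw [(hY m).variance_estimate hδ (hF m), ← Finset.sum_div]
  push_cast
  field_simp

end VarianceLimit

section StateEntropy

open Real

theorem entropyTerm_eq_negMulLog_div {Ω S : Type*} [MeasurableSpace Ω] (μ : Measure Ω)
    (X : Ω → S) (s : S) : entropyTerm μ X s = negMulLog (μ.real (X ⁻¹' {s})) / log 2 := by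
  rw [entropyTerm, negMulLog, logb]
  ring

theorem entropyBits_eq_tsum_negMulLog_div {Ω S : Type*} [MeasurableSpace Ω] (μ : Measure Ω)
    (X : Ω → S) : entropyBits μ X = (∑' s, negMulLog (μ.real (X ⁻¹' {s}))) / log 2 := by
  simp only [entropyBits, entropyTerm_eq_negMulLog_div, tsum_div_const]

variable {Ω : Type*} [MeasurableSpace Ω] {μ : Measure Ω} [IsProbabilityMeasure μ] {q : ℝ}
  {m : ℕ} {Z : ℕ → Ω → Option (Fin m × ℕ)}

theorem summable_binEntropy_notMem_occupied (hq : 1 < q) (hm : 0 < m)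
    (hZ : IsIIDSequence μ (cellLaw q m) Z) (n : ℕ) :
    Summable fun c => binEntropy (μ.real {ω | c ∉ occupied (Z · ω) n}) := by
  have : NeZero m := ⟨hm.ne'⟩
  have := hZ.isProbabilityMeasure
  simp_rw [measureReal_notMem_occupied hZ, cellLaw_real_some hq]
  exact ((cellRank m).summable_iff
    (f := fun k => binEntropy ((1 - cellArea (log q) m k) ^ n))).2
    (summable_binEntropy_one_sub_cellArea_pow (log_pos hq) hm n)

theorem summable_negMulLog_occupied (hq : 1 < q) (hm : 0 < m)
    (hZ : IsIIDSequence μ (cellLaw q m) Z) (n : ℕ) :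
    Summable fun s => negMulLog (μ.real ((fun ω => occupied (Z · ω) n) ⁻¹' {s})) :=
  summable_negMulLog_of_summable_binEntropy (measurableSet_setOf_occupied hZ n)
    (summable_binEntropy_notMem_occupied hq hm hZ n)

theorem entropyBits_occupied_le (hq : 1 < q) (hm : 0 < m)
    (hZ : IsIIDSequence μ (cellLaw q m) Z) (n : ℕ) :
    entropyBits μ (fun ω => occupied (Z · ω) n) ≤
      (∑' k, binEntropy ((1 - cellArea (log q) m k) ^ n)) / log 2 := by
  have : NeZero m := ⟨hm.ne'⟩
  have := hZ.isProbabilityMeasure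
  have h := tsum_negMulLog_le_tsum_binEntropy (measurableSet_setOf_occupied hZ n)
    (summable_binEntropy_notMem_occupied hq hm hZ n)
  simp_rw [measureReal_notMem_occupied hZ,
    tsum_comp_cellLaw_real hq fun a => binEntropy ((1 - a) ^ n)] at h
  rw [entropyBits_eq_tsum_negMulLog_div]
  exact div_le_div_of_nonneg_right h (log_nonneg one_le_two)

-- The `J m` largest cells fill the proportion `1 - q ^ (-J)` of the square, which keeps the
-- dependence between them bounded as `m` grows.
theorem le_entropyBits_occupied (hq : 1 < q) (hm : 0 < m)
    (hZ : IsIIDSequence μ (cellLaw q m) Z) {l : ℕ} (hl : 1 ≤ l) (J : ℕ) :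
    (∑ k ∈ Finset.range (J * m), binEntropy ((1 - cellArea (log q) m k) ^ (l * m)) -
      J * ((1 + l) * exp (l / exp (-(log q * J))) / exp (-(log q * J)))) / log 2 ≤
      entropyBits μ (fun ω => occupied (Z · ω) (l * m)) := by
  have : NeZero m := ⟨hm.ne'⟩
  have := hZ.isProbabilityMeasure
  have hβ := log_pos hq
  have hpartial := hZ.sum_binEntropy_sub_le_partialEntropy (T := largestCells m (J * m))
    (b := 1 / m) (B := 1 - exp (-(log q * J))) (n := l * m)
    (fun c _ => by rw [cellLaw_real_some hq]; exact cellArea_pos hβ hm _)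
    (fun c _ => by rw [cellLaw_real_some hq]; exact cellArea_le_one_div hβ m _)
    (by rw [sum_largestCells hq _ fun a => a]; exact sum_range_mul_cellArea_le hβ hm J)
    (sub_lt_self 1 (exp_pos _)) (Nat.mul_pos hl hm)
  have hlm : ((l * m : ℕ) : ℝ) * (1 / m) = l := by
    push_cast
    field_simp
  rw [sum_largestCells hq _ fun a => binEntropy ((1 - a) ^ (l * m)), card_largestCells, hlm,
    sub_sub_cancel] at hpartial
  have herror (a b c : ℝ) : ((J * m : ℕ) : ℝ) * (1 / m * a * b / c) = J * (a * b / c) := by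
    push_cast
    field_simp
  rw [herror] at hpartial
  rw [entropyBits_eq_tsum_negMulLog_div]
  exact div_le_div_of_nonneg_right (hpartial.trans (partialEntropy_le_tsum_negMulLog
    (measurableSet_setOf_occupied hZ _) (summable_negMulLog_occupied hq hm hZ _) _))
    (log_nonneg one_le_two)

theorem tendsto_entropyBits_occupied_div (hq : 1 < q)
    {Y : (m : ℕ) → ℕ → Ω → Option (Fin m × ℕ)} (hY : ∀ m, IsIIDSequence μ (cellLaw q m) (Y m))
    {l : ℕ} (hl : 1 ≤ l) :
    Tendsto (fun m : ℕ => entropyBits μ (fun ω => occupied (Y m · ω) (l * m)) / m) atTop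
      (𝓝 (limitEntropy (log q) l / log 2)) := by
  have hβ := log_pos hq
  refine tendsto_order.2 ⟨fun a ha => ?_, fun a ha => ?_⟩
  · have hJ := (intervalIntegral_tendsto_integral_Ioi 0
      (integrableOn_binEntropy_exp_neg_mul_cellDensity hβ l.cast_nonneg)
      tendsto_natCast_atTop_atTop).div_const (log 2)
    obtain ⟨J, hJ⟩ := (hJ.eventually_const_lt ha).exists
    have hm := ((tendsto_sum_range_binEntropy_div hβ l J).sub (tendsto_const_div_atTop_nhds_zero_nat
      (J * ((1 + l) * exp (l / exp (-(log q * J))) / exp (-(log q * J)))))).div_const (log 2)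
    rw [sub_zero] at hm
    filter_upwards [hm.eventually_const_lt hJ, eventually_gt_atTop 0] with m ham hm
    rw [← sub_div, div_right_comm] at ham
    exact ham.trans_le (div_le_div_of_nonneg_right
      (le_entropyBits_occupied hq hm (hY m) hl J) m.cast_nonneg)
  · filter_upwards [((tendsto_tsum_binEntropy_div hβ l).div_const (log 2)).eventually_lt_const ha,
      eventually_gt_atTop 0] with m ham hm
    rw [div_right_comm] at ham
    exact (div_le_div_of_nonneg_right
      (entropyBits_occupied_le hq hm (hY m) _) m.cast_nonneg).trans_lt ham

end StateEntropy

section IteratedLimits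

variable {f g : ℕ → ℕ → ℝ} {a b : ℝ}

theorem HasIteratedLimit.mul (hf : HasIteratedLimit f a) (hg : HasIteratedLimit g b) :
    HasIteratedLimit (fun l m => f l m * g l m) (a * b) := by
  obtain ⟨L, hfL, hLa⟩ := hf
  obtain ⟨M, hgM, hMb⟩ := hg
  exact ⟨fun l => L l * M l, fun l hl => (hfL l hl).mul (hgM l hl), hLa.mul hMb⟩

theorem HasIteratedLimit.congr (hf : HasIteratedLimit f a)
    (hfg : ∀ l m, 0 < m → f l m = g l m) : HasIteratedLimit g a := by
  obtain ⟨L, hfL, hLa⟩ := hf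
  exact ⟨L, fun l hl => (hfL l hl).congr' ((eventually_gt_atTop 0).mono (hfg l)), hLa⟩

theorem HasIteratedLimit.add_of_tendsto_zero (hf : HasIteratedLimit f a)
    (hg : ∀ l, 1 ≤ l → Tendsto (g l) atTop (𝓝 0)) :
    HasIteratedLimit (fun l m => f l m + g l m) a := by
  obtain ⟨L, hfL, hLa⟩ := hf
  exact ⟨L, fun l hl => by simpa only [add_zero] using (hfL l hl).add (hg l hl), hLa⟩

end IteratedLimits

section SmoothedPCSA

open Real

variable {Ω : Type*} [MeasurableSpace Ω] {μ : Measure Ω} {q : ℝ} {dart : ℕ → ℕ → Ω → ℝ × ℝ}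

/-- The relative variance `Var(E_{m,n}) / n²` of the martingale estimator of smoothed `q`-PCSA,
for an arbitrary base `q`; `fishmongerRelVar` is the case `q = e`. -/
noncomputable def relVar (q : ℝ) (μ : Measure Ω) (dart : ℕ → ℕ → Ω → ℝ × ℝ) (m n : ℕ) : ℝ :=
  Var[fun ω => martingaleEstimator q m (fun k => dart m k ω) n; μ] / (n : ℝ) ^ 2

/-- The Shannon entropy, in bits, of the state of smoothed `q`-PCSA, for an arbitrary base `q`;
`fishmongerEntropy` is the case `q = e`. -/
noncomputable def stateEntropy (q : ℝ) (μ : Measure Ω) (dart : ℕ → ℕ → Ω → ℝ × ℝ) (m n : ℕ) : ℝ :=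
  entropyBits μ fun ω => sketch q m (fun k => dart m k ω) n

variable [IsProbabilityMeasure μ]

theorem memLp_martingaleEstimator (hq : 1 < q) {m : ℕ} (h : IsIIDSequence μ dartLaw (dart m))
    (n : ℕ) : MemLp (fun ω => martingaleEstimator q m (fun k => dart m k ω) n) 2 μ := by
  simp_rw [martingaleEstimator_eq_estimate hq]
  have hcell : IsIIDSequence μ (cellLaw q m) _ := h.comp (measurable_cellOf hq m)
  rcases m.eq_zero_or_pos with rfl | hm
  · have hzero (y : ℕ → Option (Fin 0 × ℕ)) : estimate (cellLaw q 0) y n = 0 :=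
      Finset.sum_eq_zero fun k _ => if_neg (not_not.2 (Subsingleton.elim _ _))
    simp only [hzero, MemLp.zero']
  · have : NeZero m := ⟨hm.ne'⟩
    have := hcell.isProbabilityMeasure
    refine hcell.memLp_estimate (cellArea_pos (log_pos hq) hm n) fun s hs => ?_
    simpa only [Nat.cast_one, one_mul] using mul_cellArea_le_freeArea hq (r := 1) hs

theorem summable_entropyTerm_sketch (hq : 1 < q) {m : ℕ} (h : IsIIDSequence μ dartLaw (dart m))
    (n : ℕ) : Summable (entropyTerm μ fun ω => sketch q m (fun k => dart m k ω) n) := by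
  rcases m.eq_zero_or_pos with rfl | hm
  · exact (hasSum_fintype _).summable
  · simp_rw [funext (entropyTerm_eq_negMulLog_div μ _), sketch_eq_occupied]
    exact (summable_negMulLog_occupied hq hm (h.comp (measurable_cellOf hq m)) n).div_const _

theorem isScaleInvariant_changeProb (hq : 1 < q)
    (h : ∀ m, IsIIDSequence μ dartLaw (dart m)) :
    IsScaleInvariant μ (fun m k ω => changeProb q m (fun i => dart m i ω) k) (1 / log q) := by
  refine ⟨fun l => l * limitFreeArea (log q) l, fun l hl => ?_,
    (tendsto_mul_limitFreeArea (log_pos hq)).comp tendsto_natCast_atTop_atTop⟩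
  simp_rw [changeProb_eq_freeArea hq]
  exact (ae_tendsto_freeArea hq (fun m => (h m).comp (measurable_cellOf hq m))
    (fun m => Nat.sub_le _ _) (Nat.cast_pos.2 hl) (tendsto_mul_sub_one_div hl)).mono
    fun ω hω => hω.const_mul _

theorem hasIteratedLimit_relVar (hq : 1 < q) (h : ∀ m, IsIIDSequence μ dartLaw (dart m)) :
    HasIteratedLimit (fun l m => m * relVar q μ dart m (l * m)) (log q / 2) := by
  refine ⟨fun l => limitVariance (log q) l, fun l hl => ?_,
    (tendsto_limitVariance (log_pos hq)).comp tendsto_natCast_atTop_atTop⟩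
  simp_rw [relVar, martingaleEstimator_eq_estimate hq]
  exact tendsto_variance_estimate hq (fun m => (h m).comp (measurable_cellOf hq m)) hl

theorem hasIteratedLimit_stateEntropy (hq : 1 < q) (h : ∀ m, IsIIDSequence μ dartLaw (dart m)) :
    HasIteratedLimit (fun l m => stateEntropy q μ dart m (l * m) / m) (H0 / log q) := by
  refine ⟨fun l => limitEntropy (log q) l / log 2, fun l hl => ?_, ?_⟩
  · simp_rw [stateEntropy, sketch_eq_occupied]
    exact tendsto_entropyBits_occupied_div hq (fun m => (h m).comp (measurable_cellOf hq m)) hl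
  · have hH0 : H0 / log q = (log q)⁻¹ * (H0 * log 2) / log 2 := by
      field_simp [(log_pos one_lt_two).ne']
    rw [hH0]
    exact ((tendsto_limitEntropy (log_pos hq)).comp tendsto_natCast_atTop_atTop).div_const _

theorem hasIteratedLimit_mul_relVar (hq : 1 < q) (h : ∀ m, IsIIDSequence μ dartLaw (dart m))
    {f : ℕ → ℕ → ℝ} {a : ℝ} (hf : HasIteratedLimit (fun l m => f l m / m) (a / log q)) :
    HasIteratedLimit (fun l m => f l m * relVar q μ dart m (l * m)) (a / 2) := by
  have hlim : a / log q * (log q / 2) = a / 2 := div_mul_div_cancel₀ (log_pos hq).ne'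
  rw [← hlim]
  refine (hf.mul (hasIteratedLimit_relVar hq h)).congr fun l m hm => ?_
  rw [← mul_assoc, div_mul_cancel₀ _ (Nat.cast_ne_zero.2 hm.ne')]

end SmoothedPCSA

end Dartboard

theorem mainTheorem4_general {Ω : Type*} [MeasurableSpace Ω] (μ : Measure Ω)
    [IsProbabilityMeasure μ] {q : ℝ} (hq : 1 < q) (dart : ℕ → ℕ → Ω → ℝ × ℝ)
    (dart_measurable : ∀ m k, Measurable (dart m k))
    (dart_law : ∀ m k, μ.map (dart m k) = dartLaw)
    (dart_indep : ∀ m, iIndepFun (dart m) μ) :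
    (∀ m n, MemLp (fun ω => martingaleEstimator q m (fun k => dart m k ω) n) 2 μ) ∧
    (∀ m n, Summable (entropyTerm μ fun ω => sketch q m (fun k => dart m k ω) n)) ∧
    IsScaleInvariant μ (fun m k ω => changeProb q m (fun i => dart m i ω) k) (1 / Real.log q) ∧
    HasIteratedLimit (fun l m => m * relVar q μ dart m (l * m)) (Real.log q / 2) ∧
    HasIteratedLimit (fun l m => stateEntropy q μ dart m (l * m) / m) (H0 / Real.log q) ∧
    HasIteratedLimit
      (fun l m => stateEntropy q μ dart m (l * m) * relVar q μ dart m (l * m)) (H0 / 2) ∧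
    ∀ b : ℕ → ℕ → ℝ, (∀ l, 1 ≤ l → Tendsto (fun m : ℕ => b m (l * m) / m) atTop (𝓝 0)) →
      HasIteratedLimit
        (fun l m => (stateEntropy q μ dart m (l * m) + b m (l * m)) * relVar q μ dart m (l * m))
        (H0 / 2) := by
  have h (m : ℕ) : IsIIDSequence μ dartLaw (dart m) :=
    ⟨dart_measurable m, dart_law m, dart_indep m⟩
  have hentropy := hasIteratedLimit_stateEntropy hq h
  refine ⟨fun m => memLp_martingaleEstimator hq (h m),
    fun m => summable_entropyTerm_sketch hq (h m), isScaleInvariant_changeProb hq h,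
    hasIteratedLimit_relVar hq h, hentropy, hasIteratedLimit_mul_relVar hq h hentropy,
    fun b hb => hasIteratedLimit_mul_relVar hq h ?_⟩
  simpa only [add_div] using hentropy.add_of_tendsto_zero hb

theorem mainTheorem4 {Ω : Type*} [MeasurableSpace Ω] (μ : Measure Ω) [IsProbabilityMeasure μ]
    (dart : ℕ → ℕ → Ω → ℝ × ℝ)
    (dart_measurable : ∀ m k, Measurable (dart m k))
    (dart_law : ∀ m k, μ.map (dart m k) = dartLaw)
    (dart_indep : ∀ m, iIndepFun (dart m) μ) :
    -- all variances and entropies below are finite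
    (∀ m n, MemLp (fun ω => martingaleEstimator (Real.exp 1) m (fun k => dart m k ω) n) 2 μ) ∧
    (∀ m n, Summable
      (entropyTerm μ (fun ω => sketch (Real.exp 1) m (fun k => dart m k ω) n))) ∧
    -- scale-invariance with `κ = 1`
    IsScaleInvariant μ (fun m k ω => changeProb (Real.exp 1) m (fun i => dart m i ω) k) 1 ∧
    -- the ARV factor is `1 / 2`, and the entropy per column is `H₀`
    HasIteratedLimit (fun l m => (m : ℝ) * fishmongerRelVar μ dart m (l * m)) (1 / 2) ∧
    HasIteratedLimit (fun l m => fishmongerEntropy μ dart m (l * m) / (m : ℝ)) H0 ∧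
    -- the limiting memory-variance product is `H₀ / 2`
    HasIteratedLimit
      (fun l m => fishmongerEntropy μ dart m (l * m) * fishmongerRelVar μ dart m (l * m))
      (H0 / 2) ∧
    -- the same if the memory exceeds the entropy by `o(m)` bits, such as a register that
    -- holds the estimate
    (∀ b : ℕ → ℕ → ℝ,
      (∀ l, 1 ≤ l → Tendsto (fun m : ℕ => b m (l * m) / (m : ℝ)) atTop (𝓝 0)) →
      HasIteratedLimit
        (fun l m => (fishmongerEntropy μ dart m (l * m) + b m (l * m)) *
          fishmongerRelVar μ dart m (l * m))
        (H0 / 2)) ∧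
    -- numerical value, correct to two decimals
    |H0 / 2 - 1.63| < 0.005 := by
  obtain ⟨hmemLp, hsummable, hscale, hvariance, hentropy, hproduct, hproduct_add⟩ :=
    mainTheorem4_general μ (Real.one_lt_exp_iff.2 one_pos) dart dart_measurable dart_law dart_indep
  rw [Real.log_exp, div_one] at hscale hentropy
  rw [Real.log_exp] at hvariance
  exact ⟨hmemLp, hsummable, hscale, hvariance, hentropy, hproduct, hproduct_add,
    abs_H0_div_two_sub_lt⟩
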